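/- Let $\mathbb K$ be either the line $\mathbb R$ or the circle $\mathbb T=\mathbb R/\mathbb Z$. For $q\in L^2(\mathbb K)$ and $\kappa>0$ let $$\Lambda(q)=\Lambda(\kappa;q)=(\kappa-\partial)^{-1/2}\,q\,(\kappa+\partial)^{-1/2},\qquad \Gamma(q)=\Gamma(\kappa;q)=(\kappa+\partial)^{-1/2}\,\bar q\,(\kappa-\partial)^{-1/2}$$ as operators on $L^2(\mathbb K)$, where $(\kappa\pm\partial)^{-1/2}$ is the Fourier multiplier with symbol $(\kappa\pm i\xi)^{-1/2}$ (the branch of the square root being continuous in $\xi$ and positive at $\xi=0$), with $\xi\in\mathbb R$ if $\mathbb K=\mathbb R$ and $\xi\in2\pi\mathbb Z$ if $\mathbb K=\mathbb T$. A set $Q\subseteq L^2(\mathbb K)$ is called equicontinuous if the measures $|\hat q|^2$, $q\in Q$, form a tight family, i.e. for every $\varepsilon>0$ there is $R$ such that $\int_{|\xi|>R}|\hat q(\xi)|^2\,d\xi\le\varepsilon$ (respectively $\sum_{\xi\in2\pi\mathbb Z,\ |\xi|>R}|\hat q(\xi)|^2\le\varepsilon$) for all $q\in Q$. **Proposition.**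 Let $Q$ be a bounded and equicontinuous subset of $L^2(\mathbb K)$. For all $q\in Q$ and $\kappa>0$ the operators $\Lambda(q)$ and $\Gamma(q)$ are well-defined bounded operators on $L^2(\mathbb K)$, and $(i\kappa\Lambda(q)\Gamma(q))^\ell$ is trace class for every integer $\ell\ge1$. Moreover, $$\lim_{\kappa\to\infty}\ \sup_{q\in Q}\ \sqrt{\kappa}\,\|\Lambda(q)\|_{\mathrm{op}}=0,$$ and there exists $\kappa_0\ge1$ such that the series $$\alpha(\kappa;q)=\sum_{\ell\ge1}\frac1\ell\,\operatorname{tr}\bigl\{(i\kappa\,\Lambda(q)\Gamma(q))^{\ell}\bigr\}$$ (the expansion of $-\log\det[1-i\kappa\Lambda(q)\Gamma(q)]$) converges uniformly for $\kappa\ge\kappa_0$ and $q\in Q$. -/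

import Mathlib

open MeasureTheory Filter Topology Complex
open scoped FourierTransform ENNReal ComplexConjugate InnerProductSpace

namespace DNLS

noncomputable section

/-! ## Trace class operators -/

section Trace

universe u

variable {H : Type u} [NormedAddCommGroup H] [InnerProductSpace ℂ H] [CompleteSpace H]

/-- A bounded operator `A` on a Hilbert space is trace class if `∑ |⟨f i, A (e i)⟩| < ∞` for every
pair of orthonormal families `e`, `f`.  (With `A = U |A|` the polar decomposition, `e` an
orthonormal basis of `(ker A)ᗮ` and `f = U e`, the sum is `tr |A|`; conversely it is always at most
`tr |A|`.) -/
def IsTraceClass (A : H →L[ℂ] H) : Prop :=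
  ∀ (ι : Type u) (e f : ι → H), Orthonormal ℂ e → Orthonormal ℂ f →
    Summable fun i => ‖⟪f i, A (e i)⟫_ℂ‖

variable (H) in
/-- The index set of some orthonormal basis of `H`. -/
def basisIndex : Set H := (exists_hilbertBasis ℂ H).choose

variable (H) in
/-- Some orthonormal basis of `H`. -/
def someBasis : HilbertBasis (basisIndex H) ℂ H :=
  (exists_hilbertBasis ℂ H).choose_spec.choose

/-- The trace `∑ ⟨b i, A (b i)⟩` in an orthonormal basis `b` of `H`.  For trace class `A` the
sum converges absolutely and does not depend on the basis. -/
def trace (A : H →L[ℂ] H) : ℂ :=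
  ∑' i, ⟪someBasis H i, A (someBasis H i)⟫_ℂ

end Trace

/-! ## The symbol of `(κ ± ∂)^{-1/2}` -/

/-- `(κ + i s ξ)^{-1/2}`, the symbol of `(κ + s ∂)^{-1/2}` at the angular frequency `ξ`; it is used
for `κ > 0` and `s = ± 1`.  The principal branch is the branch that is continuous in `ξ` and
positive at `ξ = 0`. -/
def symbol (κ s ξ : ℝ) : ℂ := ((κ : ℂ) + I * s * ξ) ^ (((-1 / 2 : ℝ)) : ℂ)

theorem measurable_symbol (κ s : ℝ) : Measurable (symbol κ s) := by
  unfold symbol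
  fun_prop

theorem norm_symbol_le {κ : ℝ} (hκ : 0 < κ) (s ξ : ℝ) :
    ‖symbol κ s ξ‖ ≤ κ ^ (-1 / 2 : ℝ) := by
  unfold symbol
  rw [Complex.norm_cpow_real]
  apply Real.rpow_le_rpow_of_nonpos hκ _ (by norm_num)
  have h := Complex.re_le_norm ((κ : ℂ) + I * s * ξ)
  simpa using h

/-! ## The line -/

namespace Line

/-- `L²(ℝ)`. -/
abbrev L2 : Type := Lp ℂ 2 (volume : Measure ℝ)

open Classical in
/-- `(κ + s ∂)^{-1/2}` on `L²(ℝ)`: multiplication of the Fourier transform by `symbol κ s`.  Mathlib's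
Fourier transform uses `exp (-2 π i x ξ)`, so that its variable `ξ` is the angular frequency
`2 π ξ`. -/
def halfResolvent (κ s : ℝ) (f : L2) : L2 :=
  if h : MemLp (fun ξ : ℝ => symbol κ s (2 * Real.pi * ξ) * (𝓕 f : L2) ξ) 2 volume then
    𝓕⁻ (h.toLp _) else 0

/-- The second branch in `halfResolvent` does not occur for `κ > 0`. -/
theorem halfResolvent_spec {κ : ℝ} (hκ : 0 < κ) (s : ℝ) (f : L2) :
    (𝓕 (halfResolvent κ s f) : L2) =ᵐ[volume]
      fun ξ : ℝ => symbol κ s (2 * Real.pi * ξ) * (𝓕 f : L2) ξ := by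
  have h : MemLp (fun ξ : ℝ => symbol κ s (2 * Real.pi * ξ) * (𝓕 f : L2) ξ) 2 volume := by
    refine MemLp.of_le_mul (c := κ ^ (-1 / 2 : ℝ)) (Lp.memLp (𝓕 f : L2)) ?_ ?_
    · exact (((measurable_symbol κ s).comp
        (measurable_const.mul measurable_id)).aestronglyMeasurable).mul
          (Lp.aestronglyMeasurable _)
    · refine Eventually.of_forall fun ξ => ?_
      rw [norm_mul]
      exact mul_le_mul_of_nonneg_right (norm_symbol_le hκ _ _) (norm_nonneg _)
  rw [halfResolvent, dif_pos h, FourierTransform.fourier_fourierInv_eq]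
  exact h.coeFn_toLp

/-- `T = (κ + s ∂)^{-1/2} v (κ + t ∂)^{-1/2}` as a bounded operator on `L²(ℝ)`, where `v ∈ L²(ℝ)`: for
every `f` the product `v · (κ + t ∂)^{-1/2} f` lies in `L¹(ℝ)`, and `T f` is the `L²` function whose
Fourier transform is `symbol κ s` times that of this product. -/
def IsSandwich (κ s t : ℝ) (v : ℝ → ℂ) (T : L2 →L[ℂ] L2) : Prop :=
  ∀ f : L2, (𝓕 (T f) : L2) =ᵐ[volume]
    fun ξ : ℝ => symbol κ s (2 * Real.pi * ξ) * 𝓕 (fun x : ℝ => v x * halfResolvent κ t f x) ξ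

/-- There is at most one such operator. -/
theorem IsSandwich.unique {κ s t : ℝ} {v : ℝ → ℂ} {T T' : L2 →L[ℂ] L2}
    (h : IsSandwich κ s t v T) (h' : IsSandwich κ s t v T') : T = T' := by
  ext1 f
  have e : (𝓕 (T f) : L2) = 𝓕 (T' f) := Lp.ext ((h f).trans (h' f).symm)
  simpa using congrArg (fun g : L2 => (𝓕⁻ g : L2)) e

/-- `T = Λ(q) = (κ - ∂)^{-1/2} q (κ + ∂)^{-1/2}`. -/
def IsLambda (κ : ℝ) (q : L2) (T : L2 →L[ℂ] L2) : Prop :=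
  IsSandwich κ (-1) 1 (fun x => q x) T

/-- `T = Γ(q) = (κ + ∂)^{-1/2} q̄ (κ - ∂)^{-1/2}`. -/
def IsGamma (κ : ℝ) (q : L2) (T : L2 →L[ℂ] L2) : Prop :=
  IsSandwich κ 1 (-1) (fun x => conj (q x)) T

open Classical in
/-- The operator `Λ(q)` at the parameter `κ > 0`. -/
def Λ (κ : ℝ) (q : L2) : L2 →L[ℂ] L2 :=
  if h : ∃ T, IsLambda κ q T then h.choose else 0

open Classical in
/-- The operator `Γ(q)` at the parameter `κ > 0`. -/
def Γ (κ : ℝ) (q : L2) : L2 →L[ℂ] L2 :=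
  if h : ∃ T, IsGamma κ q T then h.choose else 0

/-- The operator `i κ Λ(q) Γ(q)`. -/
def kernelOp (κ : ℝ) (q : L2) : L2 →L[ℂ] L2 := (I * κ) • (Λ κ q * Γ κ q)

/-- The partial sum `∑_{ℓ = 1}^{n} (1/ℓ) tr ((i κ Λ Γ)^ℓ)`. -/
def alphaPartial (n : ℕ) (κ : ℝ) (q : L2) : ℂ :=
  ∑ ℓ ∈ Finset.Icc 1 n, (1 / (ℓ : ℂ)) * trace (kernelOp κ q ^ ℓ)

/-- `α(κ; q) = ∑_{ℓ ≥ 1} (1/ℓ) tr ((i κ Λ Γ)^ℓ)`. -/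
def alpha (κ : ℝ) (q : L2) : ℂ :=
  ∑' n : ℕ, (1 / ((n + 1 : ℕ) : ℂ)) * trace (kernelOp κ q ^ (n + 1))

/-- Equicontinuity in `L²(ℝ)`: the measures `|q̂(ξ)|² dξ`, `q ∈ Q`, form a tight family. -/
def IsEquicontinuous (Q : Set L2) : Prop :=
  ∀ ε : ℝ≥0∞, 0 < ε → ∃ R : ℝ, ∀ q ∈ Q,
    ∫⁻ ξ in {ξ : ℝ | R < |2 * Real.pi * ξ|}, ‖(𝓕 q : L2) ξ‖ₑ ^ 2 ≤ ε

end Line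

/-! ## The circle `ℝ / ℤ` -/

namespace Circle

/-- `L²(ℝ/ℤ)`; the Haar probability measure is Lebesgue measure on `[0, 1)`. -/
abbrev L2 : Type := Lp ℂ 2 (AddCircle.haarAddCircle : Measure UnitAddCircle)

open Classical in
/-- `(κ + s ∂)^{-1/2}` on `L²(ℝ/ℤ)`: multiplication of the `n`-th Fourier coefficient, whose angular
frequency is `2 π n`, by `symbol κ s (2 π n)`. -/
def halfResolvent (κ s : ℝ) (f : L2) : L2 :=
  if h : Memℓp (fun n : ℤ => symbol κ s (2 * Real.pi * n) * fourierCoeff f n) 2 then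
    fourierBasis.repr.symm ⟨_, h⟩ else 0

/-- The second branch in `halfResolvent` does not occur for `κ > 0`. -/
theorem halfResolvent_spec {κ : ℝ} (hκ : 0 < κ) (s : ℝ) (f : L2) (n : ℤ) :
    fourierCoeff (halfResolvent κ s f) n =
      symbol κ s (2 * Real.pi * n) * fourierCoeff f n := by
  have h : Memℓp (fun n : ℤ => symbol κ s (2 * Real.pi * n) * fourierCoeff f n) 2 := by
    refine memℓp_gen (Summable.of_nonneg_of_le (fun n => by positivity) (fun n => ?_)
      ((hasSum_sq_fourierCoeff f).summable.mul_left ((κ ^ (-1 / 2 : ℝ)) ^ 2)))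
    have hle : ‖symbol κ s (2 * Real.pi * n) * fourierCoeff f n‖ ≤
        κ ^ (-1 / 2 : ℝ) * ‖fourierCoeff f n‖ := by
      rw [norm_mul]
      exact mul_le_mul_of_nonneg_right (norm_symbol_le hκ _ _) (norm_nonneg _)
    rw [ENNReal.toReal_ofNat, Real.rpow_two, ← mul_pow]
    exact pow_le_pow_left₀ (norm_nonneg _) hle 2
  rw [halfResolvent, dif_pos h, ← fourierBasis_repr, LinearIsometryEquiv.apply_symm_apply]

/-- `T = (κ + s ∂)^{-1/2} v (κ + t ∂)^{-1/2}` as a bounded operator on `L²(ℝ/ℤ)`, where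
`v ∈ L²(ℝ/ℤ)`: for every `f` the product `v · (κ + t ∂)^{-1/2} f` lies in `L¹(ℝ/ℤ)`, and `T f` is the
`L²` function whose Fourier coefficients are `symbol κ s` times those of this product. -/
def IsSandwich (κ s t : ℝ) (v : UnitAddCircle → ℂ) (T : L2 →L[ℂ] L2) : Prop :=
  ∀ (f : L2) (n : ℤ), fourierCoeff (T f) n =
    symbol κ s (2 * Real.pi * n) * fourierCoeff (fun x => v x * halfResolvent κ t f x) n

/-- There is at most one such operator. -/
theorem IsSandwich.unique {κ s t : ℝ} {v : UnitAddCircle → ℂ} {T T' : L2 →L[ℂ] L2}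
    (h : IsSandwich κ s t v T) (h' : IsSandwich κ s t v T') : T = T' := by
  ext1 f
  apply fourierBasis.repr.injective
  ext n
  rw [fourierBasis_repr, fourierBasis_repr, h f n, h' f n]

/-- `T = Λ(q) = (κ - ∂)^{-1/2} q (κ + ∂)^{-1/2}`. -/
def IsLambda (κ : ℝ) (q : L2) (T : L2 →L[ℂ] L2) : Prop :=
  IsSandwich κ (-1) 1 (fun x => q x) T

/-- `T = Γ(q) = (κ + ∂)^{-1/2} q̄ (κ - ∂)^{-1/2}`. -/
def IsGamma (κ : ℝ) (q : L2) (T : L2 →L[ℂ] L2) : Prop :=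
  IsSandwich κ 1 (-1) (fun x => conj (q x)) T

open Classical in
/-- The operator `Λ(q)` at the parameter `κ > 0`. -/
def Λ (κ : ℝ) (q : L2) : L2 →L[ℂ] L2 :=
  if h : ∃ T, IsLambda κ q T then h.choose else 0

open Classical in
/-- The operator `Γ(q)` at the parameter `κ > 0`. -/
def Γ (κ : ℝ) (q : L2) : L2 →L[ℂ] L2 :=
  if h : ∃ T, IsGamma κ q T then h.choose else 0

/-- The operator `i κ Λ(q) Γ(q)`. -/
def kernelOp (κ : ℝ) (q : L2) : L2 →L[ℂ] L2 := (I * κ) • (Λ κ q * Γ κ q)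

/-- The partial sum `∑_{ℓ = 1}^{n} (1/ℓ) tr ((i κ Λ Γ)^ℓ)`. -/
def alphaPartial (n : ℕ) (κ : ℝ) (q : L2) : ℂ :=
  ∑ ℓ ∈ Finset.Icc 1 n, (1 / (ℓ : ℂ)) * trace (kernelOp κ q ^ ℓ)

/-- `α(κ; q) = ∑_{ℓ ≥ 1} (1/ℓ) tr ((i κ Λ Γ)^ℓ)`. -/
def alpha (κ : ℝ) (q : L2) : ℂ :=
  ∑' n : ℕ, (1 / ((n + 1 : ℕ) : ℂ)) * trace (kernelOp κ q ^ (n + 1))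

/-- Equicontinuity in `L²(ℝ/ℤ)`: the measures `∑ |q̂(ξ)|² δ_ξ`, `q ∈ Q`, form a tight family. -/
def IsEquicontinuous (Q : Set L2) : Prop :=
  ∀ ε : ℝ≥0∞, 0 < ε → ∃ R : ℝ, ∀ q ∈ Q,
    ∑' n : {n : ℤ // R < |2 * Real.pi * n|}, ‖fourierCoeff q n‖ₑ ^ 2 ≤ ε

end Circle

end

end DNLS

/-! On the Fourier side, the operator `(κ + s ∂)^{-1/2} v (κ + t ∂)^{-1/2}` has the kernel
`a(ξ) v̂(ξ - η) b(η)`, where `|a|² = |b|² = (κ² + ξ²)^{-1/2}`.  Two estimates of this kernel carry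
the proof.

* Hilbert–Schmidt norm: `|a(ξ) b(η)|² ≤ |a(ξ)|⁴ + |b(η)|⁴`, so translation invariance gives
  `‖Λ‖²_HS ≤ 2 N ‖v‖²` with `N = ∫ (κ² + ξ²)^{-1}` of order `1/κ` (`lintegral_sq_convKernel_le`).
  This yields at once the existence of the operators and the fact that the powers of `Λ Γ` are trace
  class, as products of two Hilbert–Schmidt operators.
* Operator norm: frequencies `ξ - η` in a set `S` of finite measure contribute at most
  `κ^{-2} |S| ‖v‖²` to `‖Λ‖²`, by Cauchy–Schwarz and `|a|², |b|² ≤ 1/κ`; the others contribute at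
  most the Hilbert–Schmidt bound of the tail of `v̂`, which is small relative to `1/κ` by
  equicontinuity (`sq_enorm_convOperator_le`).  Hence `√κ ‖Λ‖ → 0` uniformly on `Q`.

The series then converges by the Weierstrass test: the trace of `(iκ Λ Γ)^{ℓ+1}` is at most
`‖iκ Λ Γ‖^ℓ κ ‖Λ‖_HS ‖Γ‖_HS`, the last three factors have a bounded product, and
`‖iκ Λ Γ‖ ≤ 1/2` for large `κ`, as `√κ ‖Γ‖` is bounded (`exists_tendstoUniformlyOn_trace_series`).

All of this is done once, on an abelian group `G` with an invariant measure, which is `ℝ` with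
Lebesgue measure or `ℤ` with the counting measure.  The two geometries enter only through the
transform of a product as a convolution (`Line.fourier_mul`, `Circle.fourierCoeff_mul`) and the
value of `N`. -/

namespace DNLS

/-! ### Hilbert–Schmidt bounds and trace class products -/

section HilbertSchmidt

universe u

variable {H : Type u} [NormedAddCommGroup H] [InnerProductSpace ℂ H] [CompleteSpace H]

/-- The squared Hilbert–Schmidt norm of `A` is at most `M`.  The sum is tested on all finite
orthonormal families, so that no basis has to be chosen. -/
def HSBound (A : H →L[ℂ] H) (M : ℝ) : Prop :=
  ∀ (ι : Type u) (e : ι → H), Orthonormal ℂ e → ∀ s : Finset ι, ∑ i ∈ s, ‖A (e i)‖ ^ 2 ≤ M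

omit [CompleteSpace H] in
theorem HSBound.nonneg {A : H →L[ℂ] H} {M : ℝ} (h : HSBound A M) : 0 ≤ M := by
  have he : Orthonormal ℂ (fun i : PEmpty.{u + 1} => (i.elim : H)) :=
    ⟨fun i => i.elim, fun i => i.elim⟩
  simpa using h PEmpty _ he ∅

omit [CompleteSpace H] in
theorem HSBound.sq_norm_le {A : H →L[ℂ] H} {M : ℝ} (h : HSBound A M) : ‖A‖ ^ 2 ≤ M := by
  have hM := h.nonneg
  have key : ‖A‖ ≤ √M := by
    refine A.opNorm_le_of_unit_norm (Real.sqrt_nonneg _) fun x hx => ?_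
    refine Real.le_sqrt_of_sq_le ?_
    have he : Orthonormal ℂ (fun _ : PUnit.{u + 1} => x) :=
      ⟨fun _ => hx, fun i j hij => absurd (Subsingleton.elim i j) hij⟩
    simpa using h PUnit _ he {PUnit.unit}
  calc ‖A‖ ^ 2 ≤ √M ^ 2 := pow_le_pow_left₀ (norm_nonneg _) key 2
    _ = M := Real.sq_sqrt hM

theorem HSBound.adjoint {A : H →L[ℂ] H} {M : ℝ} (h : HSBound A M) :
    HSBound (ContinuousLinearMap.adjoint A) M := by
  intro ι f hf s
  obtain ⟨w, b, -⟩ := exists_hilbertBasis ℂ H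
  -- Expand `‖A* f i‖²` in the basis `b`, exchange the sums and apply Bessel to the family `f`.
  have hsum (x : H) : HasSum (fun j => ‖⟪b j, x⟫_ℂ‖ ^ 2) (‖x‖ ^ 2) := by
    have h2 := Complex.hasSum_re (b.hasSum_inner_mul_inner x x)
    convert h2 using 1
    · ext j
      rw [← inner_conj_symm x, Complex.conj_mul', ← Complex.ofReal_pow, Complex.ofReal_re]
    · exact (inner_self_eq_norm_sq (𝕜 := ℂ) x).symm
  have hA := hasSum_sum fun i (_ : i ∈ s) => hsum (ContinuousLinearMap.adjoint A (f i))
  refine hA.tsum_eq ▸ Real.tsum_le_of_sum_le (fun j => by positivity) fun t => ?_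
  refine le_trans (Finset.sum_le_sum fun j _ => ?_) (h w b b.orthonormal t)
  calc ∑ i ∈ s, ‖⟪b j, ContinuousLinearMap.adjoint A (f i)⟫_ℂ‖ ^ 2
      = ∑ i ∈ s, ‖⟪f i, A (b j)⟫_ℂ‖ ^ 2 := by
        refine Finset.sum_congr rfl fun i _ => ?_
        rw [ContinuousLinearMap.adjoint_inner_right, norm_inner_symm]
    _ ≤ ‖A (b j)‖ ^ 2 := hf.sum_inner_products_le _

omit [CompleteSpace H] in
theorem HSBound.mul_left {A : H →L[ℂ] H} {M : ℝ} (h : HSBound A M) (X : H →L[ℂ] H) :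
    HSBound (X * A) (‖X‖ ^ 2 * M) := by
  intro ι e he s
  calc ∑ i ∈ s, ‖(X * A) (e i)‖ ^ 2 ≤ ∑ i ∈ s, ‖X‖ ^ 2 * ‖A (e i)‖ ^ 2 :=
        Finset.sum_le_sum fun i _ => by
          rw [← mul_pow]
          exact pow_le_pow_left₀ (norm_nonneg _) (X.le_opNorm _) 2
    _ = ‖X‖ ^ 2 * ∑ i ∈ s, ‖A (e i)‖ ^ 2 := by rw [Finset.mul_sum]
    _ ≤ ‖X‖ ^ 2 * M := mul_le_mul_of_nonneg_left (h ι e he s) (by positivity)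

theorem HSBound.sum_norm_inner_mul_le {A B : H →L[ℂ] H} {M N : ℝ} (hA : HSBound A M)
    (hB : HSBound B N) {ι : Type u} {e f : ι → H} (he : Orthonormal ℂ e) (hf : Orthonormal ℂ f)
    (s : Finset ι) : ∑ i ∈ s, ‖⟪f i, (A * B) (e i)⟫_ℂ‖ ≤ √M * √N := by
  calc ∑ i ∈ s, ‖⟪f i, (A * B) (e i)⟫_ℂ‖
      ≤ ∑ i ∈ s, ‖ContinuousLinearMap.adjoint A (f i)‖ * ‖B (e i)‖ :=
        Finset.sum_le_sum fun i _ => by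
          rw [mul_apply_eq_comp, ← ContinuousLinearMap.adjoint_inner_left]
          exact norm_inner_le_norm _ _
    _ ≤ √(∑ i ∈ s, ‖ContinuousLinearMap.adjoint A (f i)‖ ^ 2) * √(∑ i ∈ s, ‖B (e i)‖ ^ 2) :=
        Real.sum_mul_le_sqrt_mul_sqrt _ _ _
    _ ≤ √M * √N := mul_le_mul (Real.sqrt_le_sqrt (hA.adjoint ι f hf s))
        (Real.sqrt_le_sqrt (hB ι e he s)) (Real.sqrt_nonneg _) (Real.sqrt_nonneg _)

theorem HSBound.isTraceClass_mul {A B : H →L[ℂ] H} {M N : ℝ} (hA : HSBound A M)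
    (hB : HSBound B N) : IsTraceClass (A * B) := fun _ _ _ he hf =>
  summable_of_sum_le (fun _ => norm_nonneg _) (hA.sum_norm_inner_mul_le hB he hf)

theorem HSBound.norm_trace_mul_le {A B : H →L[ℂ] H} {M N : ℝ} (hA : HSBound A M)
    (hB : HSBound B N) : ‖trace (A * B)‖ ≤ √M * √N := by
  have ho := (someBasis H).orthonormal
  have hs := hA.isTraceClass_mul hB _ _ _ ho ho
  exact (norm_tsum_le_tsum_norm hs).trans
    (hs.tsum_le_of_sum_le (hA.sum_norm_inner_mul_le hB ho ho))

omit [CompleteSpace H] in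
/-- Hilbert–Schmidt bounds are invariant under unitary equivalence. -/
theorem HSBound.conj_unitary {H' : Type u} [NormedAddCommGroup H'] [InnerProductSpace ℂ H']
    {A : H' →L[ℂ] H'} {M : ℝ} (h : HSBound A M) (U : H ≃ₗᵢ[ℂ] H') {T : H →L[ℂ] H}
    (hT : ∀ f, U (T f) = A (U f)) : HSBound T M := by
  intro ι e he s
  have := h ι _ (he.comp_linearIsometryEquiv U) s
  simpa [← hT] using this

omit [CompleteSpace H] in
theorem norm_le_of_conj_unitary {H' : Type u} [NormedAddCommGroup H'] [InnerProductSpace ℂ H']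
    {A : H' →L[ℂ] H'} (U : H ≃ₗᵢ[ℂ] H') {T : H →L[ℂ] H}
    (hT : ∀ f, U (T f) = A (U f)) : ‖T‖ ≤ ‖A‖ := by
  refine T.opNorm_le_bound (norm_nonneg _) fun f => ?_
  rw [← U.norm_map (T f), hT, ← U.norm_map f]
  exact A.le_opNorm _

end HilbertSchmidt

/-! ### From operator bounds to the limit and to the convergence of the series -/

section Abstract

universe u

variable {H : Type u} [NormedAddCommGroup H] [InnerProductSpace ℂ H] [CompleteSpace H]

theorem isTraceClass_pow {L G : H →L[ℂ] H} {M N : ℝ} (hL : HSBound L M) (hG : HSBound G N)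
    (c : ℂ) {ℓ : ℕ} (hℓ : 1 ≤ ℓ) : IsTraceClass ((c • (L * G)) ^ ℓ) := by
  obtain ⟨n, rfl⟩ := Nat.exists_eq_add_of_le' hℓ
  have e : (c • (L * G)) ^ (n + 1) = (((c • (L * G)) ^ n * (c • 1)) * L) * G := by
    rw [pow_succ]
    simp [mul_assoc]
  rw [e]
  exact (hL.mul_left _).isTraceClass_mul hG

/-- `|tr (c L G)^{n+1}| ≤ ‖c L G‖^n |c| ‖L‖_HS ‖G‖_HS`. -/
theorem norm_trace_pow_le {L G : H →L[ℂ] H} {M N : ℝ} (hL : HSBound L M) (hG : HSBound G N)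
    (c : ℂ) (n : ℕ) :
    ‖trace ((c • (L * G)) ^ (n + 1))‖ ≤ ‖c • (L * G)‖ ^ n * (‖c‖ * (√M * √N)) := by
  have e : (c • (L * G)) ^ (n + 1) = (((c • (L * G)) ^ n * (c • 1)) * L) * G := by
    rw [pow_succ]
    simp [mul_assoc]
  rw [e]
  refine ((hL.mul_left _).norm_trace_mul_le hG).trans ?_
  rw [Real.sqrt_mul (by positivity), Real.sqrt_sq (norm_nonneg _), mul_assoc,
    ← mul_assoc (‖c • (L * G)‖ ^ n)]
  refine mul_le_mul_of_nonneg_right ?_ (mul_nonneg (Real.sqrt_nonneg _) (Real.sqrt_nonneg _))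
  have h1 : ‖(c • (1 : H →L[ℂ] H))‖ ≤ ‖c‖ := by
    rw [norm_smul]
    exact mul_le_of_le_one_right (norm_nonneg _) ContinuousLinearMap.norm_id_le
  have h2 : ‖(c • (L * G)) ^ n‖ ≤ ‖c • (L * G)‖ ^ n := by
    rcases Nat.eq_zero_or_pos n with rfl | hn
    · simpa using! ContinuousLinearMap.norm_id_le
    · exact norm_pow_le' _ hn
  exact (norm_mul_le _ _).trans (mul_le_mul h2 h1 (norm_nonneg _) (pow_nonneg (norm_nonneg _) _))

omit [CompleteSpace H] in
/-- The limit of `√κ ‖L‖`, from a bound on `κ ‖L‖²` by an arbitrarily small constant and a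
term of order `1/κ`. -/
theorem tendsto_iSup_sqrt_mul_norm {L : ℝ → H → H →L[ℂ] H} {Q : Set H}
    (h : ∀ ε : ℝ, 0 < ε → ∃ D : ℝ, ∀ κ : ℝ, 1 ≤ κ → ∀ q ∈ Q, κ * ‖L κ q‖ ^ 2 ≤ D / κ + ε) :
    Tendsto (fun κ : ℝ => ⨆ q ∈ Q, ENNReal.ofReal (√κ * ‖L κ q‖)) atTop (𝓝 0) := by
  rw [ENNReal.tendsto_nhds_zero]
  intro ε hε
  obtain ⟨r, hr, hrε⟩ : ∃ r : ℝ, 0 < r ∧ ENNReal.ofReal r ≤ ε := by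
    rcases eq_or_ne ε ⊤ with rfl | h'
    · exact ⟨1, one_pos, le_top⟩
    · exact ⟨ε.toReal, ENNReal.toReal_pos hε.ne' h', by rw [ENNReal.ofReal_toReal h']⟩
  obtain ⟨D, hD⟩ := h (r ^ 2 / 2) (by positivity)
  have hlim : Tendsto (fun κ : ℝ => D / κ) atTop (𝓝 0) := tendsto_const_nhds.div_atTop tendsto_id
  filter_upwards [eventually_ge_atTop 1, hlim.eventually_le_const (half_pos (pow_pos hr 2))]
    with κ hκ hDκ
  refine iSup₂_le fun q hq => le_trans (ENNReal.ofReal_le_ofReal ?_) hrε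
  refine (sq_le_sq₀ (by positivity) hr.le).1 ?_
  rw [mul_pow, Real.sq_sqrt (by linarith)]
  linarith [hD κ hκ q hq]

/-- The Weierstrass test for the trace series: the Hilbert–Schmidt norms of `√κ L` and `√κ G` are
bounded and the operator norm of `√κ L` tends to zero uniformly. -/
theorem exists_tendstoUniformlyOn_trace_series {L G : ℝ → H → H →L[ℂ] H} {Q : Set H} {C : ℝ}
    (hL : ∀ κ : ℝ, 1 ≤ κ → ∀ q ∈ Q, HSBound (L κ q) (C / κ))
    (hG : ∀ κ : ℝ, 1 ≤ κ → ∀ q ∈ Q, HSBound (G κ q) (C / κ))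
    (hlim : Tendsto (fun κ : ℝ => ⨆ q ∈ Q, ENNReal.ofReal (√κ * ‖L κ q‖)) atTop (𝓝 0)) :
    ∃ κ₀ : ℝ, 1 ≤ κ₀ ∧ TendstoUniformlyOn
      (fun (n : ℕ) (p : ℝ × H) => ∑ ℓ ∈ Finset.Icc 1 n,
        (1 / (ℓ : ℂ)) * trace (((I * p.1) • (L p.1 p.2 * G p.1 p.2)) ^ ℓ))
      (fun p => ∑' n : ℕ, (1 / ((n + 1 : ℕ) : ℂ)) *
        trace (((I * p.1) • (L p.1 p.2 * G p.1 p.2)) ^ (n + 1))) atTop (Set.Ici κ₀ ×ˢ Q) := by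
  -- As `√κ ‖G‖ ≤ √C`, the bound `√κ ‖L‖ ≤ 1 / (2 (√C + 1))` gives `κ ‖L G‖ ≤ 1/2`.
  have hδ : 0 < 1 / (2 * (√C + 1)) := by positivity
  obtain ⟨κ₁, hκ₁⟩ := eventually_atTop.1
    (ENNReal.tendsto_nhds_zero.1 hlim _ (ENNReal.ofReal_pos.2 hδ))
  refine ⟨max 1 κ₁, le_max_left _ _, ?_⟩
  have hsum : Summable fun n : ℕ => (1 / 2 : ℝ) ^ n * C :=
    (summable_geometric_of_lt_one (by norm_num) (by norm_num)).mul_right C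
  have hmain := tendstoUniformlyOn_tsum_nat (s := Set.Ici (max 1 κ₁) ×ˢ Q)
    (f := fun (n : ℕ) (p : ℝ × H) => (1 / ((n + 1 : ℕ) : ℂ)) *
      trace (((I * p.1) • (L p.1 p.2 * G p.1 p.2)) ^ (n + 1))) hsum ?_
  · refine hmain.congr (Eventually.of_forall fun n p _ => ?_)
    change ∑ k ∈ Finset.range n, _ = _
    rw [Finset.range_eq_Ico, ← Finset.Ico_add_one_right_eq_Icc,
      Finset.sum_Ico_add' (fun ℓ : ℕ => (1 / (ℓ : ℂ)) *
        trace (((I * p.1) • (L p.1 p.2 * G p.1 p.2)) ^ ℓ)) 0 n 1]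
  · rintro n ⟨κ, q⟩ ⟨hκ, hq⟩
    have hκ1 : 1 ≤ κ := (le_max_left _ _).trans hκ
    have hκ0 : 0 < κ := by linarith
    have hHL := hL κ hκ1 q hq
    have hHG := hG κ hκ1 q hq
    have hC : 0 ≤ C := by
      have := mul_nonneg hHL.nonneg hκ0.le
      rwa [div_mul_cancel₀ _ hκ0.ne'] at this
    have hLs : √κ * ‖L κ q‖ ≤ 1 / (2 * (√C + 1)) := by
      have := (le_iSup₂ (f := fun q (_ : q ∈ Q) => ENNReal.ofReal (√κ * ‖L κ q‖)) q hq).trans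
        (hκ₁ κ ((le_max_right _ _).trans hκ))
      exact (ENNReal.ofReal_le_ofReal_iff hδ.le).1 this
    have hGs : √κ * ‖G κ q‖ ≤ √C := by
      refine Real.le_sqrt_of_sq_le ?_
      rw [mul_pow, Real.sq_sqrt hκ0.le]
      have := mul_le_mul_of_nonneg_left hHG.sq_norm_le hκ0.le
      rwa [mul_div_cancel₀ _ hκ0.ne'] at this
    have hnI : ‖I * (κ : ℂ)‖ = κ := by simp [abs_of_pos hκ0]
    have hop : ‖(I * (κ : ℂ)) • (L κ q * G κ q)‖ ≤ 1 / 2 := by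
      rw [norm_smul, hnI]
      calc κ * ‖L κ q * G κ q‖ ≤ (√κ * √κ) * (‖L κ q‖ * ‖G κ q‖) := by
            rw [Real.mul_self_sqrt hκ0.le]
            exact mul_le_mul_of_nonneg_left (norm_mul_le _ _) hκ0.le
        _ = (√κ * ‖L κ q‖) * (√κ * ‖G κ q‖) := by ring
        _ ≤ 1 / (2 * (√C + 1)) * √C := mul_le_mul hLs hGs (by positivity) hδ.le
        _ ≤ 1 / 2 := by
            have := Real.sqrt_nonneg C
            rw [div_mul_eq_mul_div, div_le_div_iff₀ (by positivity) (by norm_num)]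
            linarith
    have htr := norm_trace_pow_le hHL hHG (I * (κ : ℂ)) n
    rw [hnI, Real.mul_self_sqrt hHL.nonneg, mul_div_cancel₀ _ hκ0.ne'] at htr
    calc ‖(1 / ((n + 1 : ℕ) : ℂ)) * trace (((I * κ) • (L κ q * G κ q)) ^ (n + 1))‖
        ≤ 1 * ‖trace (((I * (κ : ℂ)) • (L κ q * G κ q)) ^ (n + 1))‖ := by
          rw [norm_mul]
          refine mul_le_mul_of_nonneg_right ?_ (norm_nonneg _)
          rw [norm_div, norm_one, Complex.norm_natCast]
          exact div_le_one_of_le₀ (by norm_cast; omega) (by positivity)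
      _ ≤ (1 / 2) ^ n * C := by
          rw [one_mul]
          exact htr.trans (mul_le_mul_of_nonneg_right (pow_le_pow_left₀ (norm_nonneg _) hop n) hC)

end Abstract

/-! ### Integral operators with square integrable kernels -/

section Kernel

universe u

variable {X : Type u} [MeasurableSpace X] {μ : Measure X}

/-- The Cauchy–Schwarz inequality. -/
theorem sq_lintegral_mul_le {f g : X → ℝ≥0∞} (hf : AEMeasurable f μ) (hg : AEMeasurable g μ) :
    (∫⁻ x, f x * g x ∂μ) ^ 2 ≤ (∫⁻ x, f x ^ 2 ∂μ) * ∫⁻ x, g x ^ 2 ∂μ := by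
  have h := ENNReal.lintegral_mul_le_Lp_mul_Lq μ Real.HolderConjugate.two_two hf hg
  simp only [Pi.mul_apply, ENNReal.rpow_two] at h
  calc (∫⁻ x, f x * g x ∂μ) ^ 2
      ≤ ((∫⁻ x, f x ^ 2 ∂μ) ^ (1 / 2 : ℝ) * (∫⁻ x, g x ^ 2 ∂μ) ^ (1 / 2 : ℝ)) ^ 2 := by gcongr
    _ = (∫⁻ x, f x ^ 2 ∂μ) * ∫⁻ x, g x ^ 2 ∂μ := by
        rw [mul_pow, ← ENNReal.rpow_two, ← ENNReal.rpow_two, ← ENNReal.rpow_mul,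
          ← ENNReal.rpow_mul]
        norm_num

theorem sq_eLpNorm_two (f : X → ℂ) : eLpNorm f 2 μ ^ 2 = ∫⁻ x, ‖f x‖ₑ ^ 2 ∂μ := by
  have := eLpNorm_nnreal_pow_eq_lintegral (f := f) (μ := μ) (p := 2) (by norm_num)
  simpa [ENNReal.rpow_two] using this

theorem sq_enorm_Lp (f : Lp ℂ 2 μ) : ‖f‖ₑ ^ 2 = ∫⁻ x, ‖f x‖ₑ ^ 2 ∂μ := by
  rw [Lp.enorm_def, sq_eLpNorm_two]

theorem memLp_two_of_lintegral {f : X → ℂ} (hf : AEStronglyMeasurable f μ)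
    (h : ∫⁻ x, ‖f x‖ₑ ^ 2 ∂μ ≠ ∞) : MemLp f 2 μ := by
  refine ⟨hf, ?_⟩
  rw [← sq_eLpNorm_two] at h
  by_contra h'
  rw [not_lt, top_le_iff] at h'
  simp [h'] at h

theorem exists_Lp_conj (q : Lp ℂ 2 μ) :
    ∃ r : Lp ℂ 2 μ, ‖r‖ = ‖q‖ ∧ r =ᵐ[μ] fun x => conj (q x) := by
  have h : (star q : Lp ℂ 2 μ) =ᵐ[μ] fun x => conj (q x) := Lp.coeFn_star q
  refine ⟨star q, ?_, h⟩
  refine congrArg ENNReal.toReal (eLpNorm_congr_norm_ae ?_)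
  filter_upwards [h] with x hx
  rw [hx, RCLike.norm_conj]

variable [SFinite μ] {K : X → X → ℂ}

theorem ae_memLp_kernel (hK : StronglyMeasurable (Function.uncurry K))
    (hfin : ∫⁻ ξ, ∫⁻ η, ‖K ξ η‖ₑ ^ 2 ∂μ ∂μ ≠ ∞) : ∀ᵐ ξ ∂μ, MemLp (K ξ) 2 μ := by
  have hm : Measurable fun ξ => ∫⁻ η, ‖K ξ η‖ₑ ^ 2 ∂μ :=
    (hK.measurable.enorm.pow_const 2).lintegral_prod_right'
  filter_upwards [ae_lt_top hm hfin] with ξ hξ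
  exact memLp_two_of_lintegral
    (hK.comp_measurable measurable_prodMk_left).aestronglyMeasurable hξ.ne

omit [SFinite μ] in
theorem sq_enorm_integral_kernel_le (hK : StronglyMeasurable (Function.uncurry K)) (g : Lp ℂ 2 μ)
    (ξ : X) : ‖∫ η, K ξ η * g η ∂μ‖ₑ ^ 2 ≤ (∫⁻ η, ‖K ξ η‖ₑ ^ 2 ∂μ) * ‖g‖ₑ ^ 2 := by
  rw [sq_enorm_Lp]
  refine le_trans (pow_le_pow_left₀ (zero_le) (enorm_integral_le_lintegral_enorm _) 2) ?_
  simp_rw [enorm_mul]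
  exact sq_lintegral_mul_le
    (hK.comp_measurable measurable_prodMk_left).measurable.enorm.aemeasurable
    (Lp.stronglyMeasurable g).measurable.enorm.aemeasurable

theorem lintegral_sq_enorm_integral_kernel_le (hK : StronglyMeasurable (Function.uncurry K))
    (g : Lp ℂ 2 μ) : ∫⁻ ξ, ‖∫ η, K ξ η * g η ∂μ‖ₑ ^ 2 ∂μ ≤
      (∫⁻ ξ, ∫⁻ η, ‖K ξ η‖ₑ ^ 2 ∂μ ∂μ) * ‖g‖ₑ ^ 2 := by
  have hm : Measurable fun ξ => ∫⁻ η, ‖K ξ η‖ₑ ^ 2 ∂μ :=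
    (hK.measurable.enorm.pow_const 2).lintegral_prod_right'
  rw [← lintegral_mul_const _ hm]
  exact lintegral_mono fun ξ => sq_enorm_integral_kernel_le hK g ξ

theorem stronglyMeasurable_integral_kernel (hK : StronglyMeasurable (Function.uncurry K))
    (g : Lp ℂ 2 μ) : StronglyMeasurable fun ξ => ∫ η, K ξ η * g η ∂μ :=
  StronglyMeasurable.integral_prod_right
    (hK.mul ((Lp.stronglyMeasurable g).comp_measurable measurable_snd))

/-- A square integrable kernel defines a bounded operator on `L²`. -/
theorem exists_kernelOperator (hK : StronglyMeasurable (Function.uncurry K))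
    (hfin : ∫⁻ ξ, ∫⁻ η, ‖K ξ η‖ₑ ^ 2 ∂μ ∂μ ≠ ∞) :
    ∃ T : Lp ℂ 2 μ →L[ℂ] Lp ℂ 2 μ, ∀ g, T g =ᵐ[μ] fun ξ => ∫ η, K ξ η * g η ∂μ := by
  have hmem (g : Lp ℂ 2 μ) : MemLp (fun ξ => ∫ η, K ξ η * g η ∂μ) 2 μ :=
    memLp_two_of_lintegral (stronglyMeasurable_integral_kernel hK g).aestronglyMeasurable
      (ne_top_of_le_ne_top (ENNReal.mul_ne_top hfin (by finiteness))
        (lintegral_sq_enorm_integral_kernel_le hK g))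
  let L : Lp ℂ 2 μ →ₗ[ℂ] Lp ℂ 2 μ :=
    { toFun := fun g => (hmem g).toLp _
      map_add' := fun g h => by
        rw [← MemLp.toLp_add, MemLp.toLp_eq_toLp_iff]
        filter_upwards [ae_memLp_kernel hK hfin] with ξ hξ
        refine Eq.trans ?_ (integral_add (hξ.integrable_mul (Lp.memLp g))
          (hξ.integrable_mul (Lp.memLp h)))
        refine integral_congr_ae ?_
        filter_upwards [Lp.coeFn_add g h] with η hη
        simp only [hη, Pi.add_apply, mul_add]
      map_smul' := fun c g => by
        rw [RingHom.id_apply, ← MemLp.toLp_const_smul, MemLp.toLp_eq_toLp_iff]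
        refine Eventually.of_forall fun ξ => ?_
        rw [Pi.smul_apply, ← integral_smul]
        refine integral_congr_ae ?_
        filter_upwards [Lp.coeFn_smul c g] with η hη
        rw [hη, Pi.smul_apply, smul_eq_mul, smul_eq_mul, mul_left_comm] }
  refine ⟨L.mkContinuous (√(∫⁻ ξ, ∫⁻ η, ‖K ξ η‖ₑ ^ 2 ∂μ ∂μ).toReal) fun g => ?_,
    fun g => (hmem g).coeFn_toLp⟩
  refine (sq_le_sq₀ (norm_nonneg _) (by positivity)).1 ?_
  rw [mul_pow, Real.sq_sqrt ENNReal.toReal_nonneg]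
  have h : ‖L g‖ₑ ^ 2 ≤ (∫⁻ ξ, ∫⁻ η, ‖K ξ η‖ₑ ^ 2 ∂μ ∂μ) * ‖g‖ₑ ^ 2 := by
    rw [sq_enorm_Lp]
    refine le_trans (lintegral_congr_ae ?_).le (lintegral_sq_enorm_integral_kernel_le hK g)
    filter_upwards [(hmem g).coeFn_toLp] with ξ hξ
    rw [← hξ]
    rfl
  have h2 := ENNReal.toReal_mono (ENNReal.mul_ne_top hfin (by finiteness)) h
  simpa [ENNReal.toReal_mul, ENNReal.toReal_pow] using h2

/-- The Hilbert–Schmidt norm of an integral operator is at most the `L²` norm of its kernel: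
Bessel's inequality for the functions `K ξ`. -/
theorem hsBound_of_kernel (hK : StronglyMeasurable (Function.uncurry K)) {M : ℝ} (hM : 0 ≤ M)
    (hKM : ∫⁻ ξ, ∫⁻ η, ‖K ξ η‖ₑ ^ 2 ∂μ ∂μ ≤ ENNReal.ofReal M) {T : Lp ℂ 2 μ →L[ℂ] Lp ℂ 2 μ}
    (hT : ∀ g, T g =ᵐ[μ] fun ξ => ∫ η, K ξ η * g η ∂μ) : HSBound T M := by
  intro ι e he s
  have hfin := ne_top_of_le_ne_top ENNReal.ofReal_ne_top hKM
  rw [← ENNReal.ofReal_le_ofReal_iff hM, ENNReal.ofReal_sum_of_nonneg fun _ _ => by positivity]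
  calc ∑ i ∈ s, ENNReal.ofReal (‖T (e i)‖ ^ 2)
      = ∑ i ∈ s, ∫⁻ ξ, ‖∫ η, K ξ η * e i η ∂μ‖ₑ ^ 2 ∂μ := by
        refine Finset.sum_congr rfl fun i _ => ?_
        rw [ENNReal.ofReal_pow (norm_nonneg _), ofReal_norm, sq_enorm_Lp]
        refine lintegral_congr_ae ?_
        filter_upwards [hT (e i)] with ξ hξ
        rw [hξ]
    _ = ∫⁻ ξ, ∑ i ∈ s, ‖∫ η, K ξ η * e i η ∂μ‖ₑ ^ 2 ∂μ :=
        (lintegral_finsetSum _ fun i _ =>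
          (stronglyMeasurable_integral_kernel hK (e i)).measurable.enorm.pow_const 2).symm
    _ ≤ ∫⁻ ξ, ∫⁻ η, ‖K ξ η‖ₑ ^ 2 ∂μ ∂μ := by
        refine lintegral_mono_ae ?_
        filter_upwards [ae_memLp_kernel hK hfin] with ξ hξ
        have hs : MemLp (fun η => conj (K ξ η)) 2 μ := hξ.star
        have hin (g : Lp ℂ 2 μ) : ∫ η, K ξ η * g η ∂μ = ⟪hs.toLp _, g⟫_ℂ := by
          rw [L2.inner_def]
          refine integral_congr_ae ?_
          filter_upwards [hs.coeFn_toLp] with η hη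
          simp [hη, mul_comm]
        have hb := he.sum_inner_products_le (hs.toLp _) (s := s)
        have hn : ENNReal.ofReal (‖hs.toLp _‖ ^ 2) = ∫⁻ η, ‖K ξ η‖ₑ ^ 2 ∂μ := by
          rw [ENNReal.ofReal_pow (norm_nonneg _), ofReal_norm, sq_enorm_Lp]
          refine lintegral_congr_ae ?_
          filter_upwards [hs.coeFn_toLp] with η hη
          rw [hη, RCLike.enorm_conj]
        rw [← hn]
        refine le_trans (le_of_eq ?_) (ENNReal.ofReal_le_ofReal hb)
        rw [ENNReal.ofReal_sum_of_nonneg fun _ _ => by positivity]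
        refine Finset.sum_congr rfl fun i _ => ?_
        rw [ENNReal.ofReal_pow (norm_nonneg _), ofReal_norm, hin, ← inner_conj_symm,
          RCLike.enorm_conj]
    _ ≤ ENNReal.ofReal M := hKM

end Kernel

/-! ### Weighted convolution operators -/

section Convolution

universe u

variable {G : Type u} [AddCommGroup G] [MeasurableSpace G] [MeasurableAdd₂ G] [MeasurableNeg G]
  [MeasurableSub₂ G] {μ : Measure G} [SFinite μ] [μ.IsAddLeftInvariant] [μ.IsNegInvariant]

omit [SFinite μ] in
theorem lintegral_lintegral_left_weight {A W : G → ℝ≥0∞} (hA : Measurable A)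
    (hW : Measurable W) :
    ∫⁻ ξ, ∫⁻ η, A ξ * W (ξ - η) ∂μ ∂μ = (∫⁻ ξ, A ξ ∂μ) * ∫⁻ ξ, W ξ ∂μ := by
  rw [← lintegral_mul_const _ hA]
  refine lintegral_congr fun ξ => ?_
  rw [← lintegral_sub_left_eq_self W ξ, lintegral_const_mul]
  exact hW.comp (measurable_const.sub measurable_id)

omit [MeasurableNeg G] [μ.IsNegInvariant] in
theorem lintegral_lintegral_right_weight {A W : G → ℝ≥0∞} (hA : Measurable A) (hW : Measurable W) :
    ∫⁻ ξ, ∫⁻ η, A η * W (ξ - η) ∂μ ∂μ = (∫⁻ ξ, A ξ ∂μ) * ∫⁻ ξ, W ξ ∂μ := by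
  rw [lintegral_lintegral_swap ((hA.comp measurable_snd).mul
    (hW.comp (measurable_fst.sub measurable_snd))).aemeasurable, ← lintegral_mul_const _ hA]
  refine lintegral_congr fun η => ?_
  rw [← lintegral_sub_right_eq_self W η, lintegral_const_mul]
  exact hW.comp (measurable_id.sub measurable_const)

/-- The kernel `a(ξ) w(ξ - η) b(η)` of the operator `a (w ∗ (b ·))`, the form that the operator
`A v B` takes on the Fourier side when `A`, `B` are Fourier multipliers and `w` is the Fourier
transform of `v`. -/
def convKernel (a b w : G → ℂ) (ξ η : G) : ℂ := a ξ * w (ξ - η) * b η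

variable {a b w : G → ℂ}

omit [MeasurableAdd₂ G] [MeasurableNeg G] in
theorem stronglyMeasurable_convKernel (ha : Measurable a) (hb : Measurable b) (hw : Measurable w) :
    StronglyMeasurable (Function.uncurry (convKernel a b w)) :=
  (((ha.comp measurable_fst).mul (hw.comp (measurable_fst.sub measurable_snd))).mul
    (hb.comp measurable_snd)).stronglyMeasurable

/-- Since `|a(ξ) b(η)|² ≤ |a(ξ)|⁴ + |b(η)|⁴`, square integrability of the kernel only needs
`a, b ∈ L⁴`. -/
theorem lintegral_sq_convKernel_le (ha : Measurable a) (hb : Measurable b) (hw : Measurable w)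
    {N : ℝ≥0∞} (haN : ∫⁻ ξ, ‖a ξ‖ₑ ^ 4 ∂μ ≤ N) (hbN : ∫⁻ ξ, ‖b ξ‖ₑ ^ 4 ∂μ ≤ N) :
    ∫⁻ ξ, ∫⁻ η, ‖convKernel a b w ξ η‖ₑ ^ 2 ∂μ ∂μ ≤ 2 * N * ∫⁻ ξ, ‖w ξ‖ₑ ^ 2 ∂μ := by
  have ha4 := ha.enorm.pow_const 4
  have hb4 := hb.enorm.pow_const 4
  have hw2 := hw.enorm.pow_const 2
  have hAW : Measurable (Function.uncurry fun ξ η : G => ‖a ξ‖ₑ ^ 4 * ‖w (ξ - η)‖ₑ ^ 2) :=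
    (ha4.comp measurable_fst).mul (hw2.comp (measurable_fst.sub measurable_snd))
  have hpt (x y : ℝ≥0∞) : x ^ 2 * y ^ 2 ≤ x ^ 4 + y ^ 4 := by
    rcases le_total x y with h | h
    · calc x ^ 2 * y ^ 2 ≤ y ^ 2 * y ^ 2 := by gcongr
        _ = y ^ 4 := by ring
        _ ≤ _ := le_add_self
    · calc x ^ 2 * y ^ 2 ≤ x ^ 2 * x ^ 2 := by gcongr
        _ = x ^ 4 := by ring
        _ ≤ _ := le_self_add
  calc ∫⁻ ξ, ∫⁻ η, ‖convKernel a b w ξ η‖ₑ ^ 2 ∂μ ∂μ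
      ≤ ∫⁻ ξ, ∫⁻ η, (‖a ξ‖ₑ ^ 4 * ‖w (ξ - η)‖ₑ ^ 2 + ‖b η‖ₑ ^ 4 * ‖w (ξ - η)‖ₑ ^ 2) ∂μ ∂μ := by
        refine lintegral_mono fun ξ => lintegral_mono fun η => ?_
        calc ‖convKernel a b w ξ η‖ₑ ^ 2
            = ‖a ξ‖ₑ ^ 2 * ‖b η‖ₑ ^ 2 * ‖w (ξ - η)‖ₑ ^ 2 := by
              rw [convKernel, enorm_mul, enorm_mul]
              ring
          _ ≤ (‖a ξ‖ₑ ^ 4 + ‖b η‖ₑ ^ 4) * ‖w (ξ - η)‖ₑ ^ 2 := by gcongr; exact hpt _ _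
          _ = _ := add_mul _ _ _
    _ = ∫⁻ ξ, (∫⁻ η, ‖a ξ‖ₑ ^ 4 * ‖w (ξ - η)‖ₑ ^ 2 ∂μ) +
          ∫⁻ η, ‖b η‖ₑ ^ 4 * ‖w (ξ - η)‖ₑ ^ 2 ∂μ ∂μ :=
        lintegral_congr fun ξ => lintegral_add_left (hAW.comp measurable_prodMk_left) _
    _ = (∫⁻ ξ, ‖a ξ‖ₑ ^ 4 ∂μ) * (∫⁻ ξ, ‖w ξ‖ₑ ^ 2 ∂μ) +
          (∫⁻ ξ, ‖b ξ‖ₑ ^ 4 ∂μ) * ∫⁻ ξ, ‖w ξ‖ₑ ^ 2 ∂μ := by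
        have hm : Measurable fun ξ => ∫⁻ η, ‖a ξ‖ₑ ^ 4 * ‖w (ξ - η)‖ₑ ^ 2 ∂μ :=
          hAW.lintegral_prod_right'
        rw [lintegral_add_left hm, ← lintegral_lintegral_left_weight ha4 hw2, ← lintegral_lintegral_right_weight hb4 hw2]
    _ ≤ N * (∫⁻ ξ, ‖w ξ‖ₑ ^ 2 ∂μ) + N * ∫⁻ ξ, ‖w ξ‖ₑ ^ 2 ∂μ := by gcongr
    _ = 2 * N * ∫⁻ ξ, ‖w ξ‖ₑ ^ 2 ∂μ := by ring

/-- The operator norm of `a (w ∗ (b ·))`: on the set `S` of finite measure the multipliers are only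
bounded by their supremum, and off `S` the Hilbert–Schmidt norm is used. -/
theorem sq_enorm_convOperator_le (ha : Measurable a) (hb : Measurable b) (hw : Measurable w)
    {N c : ℝ≥0∞} (haN : ∫⁻ ξ, ‖a ξ‖ₑ ^ 4 ∂μ ≤ N) (hbN : ∫⁻ ξ, ‖b ξ‖ₑ ^ 4 ∂μ ≤ N)
    (hac : ∀ ξ, ‖a ξ‖ₑ ^ 2 ≤ c) (hbc : ∀ ξ, ‖b ξ‖ₑ ^ 2 ≤ c)
    {S : Set G} (hS : MeasurableSet S) {T : Lp ℂ 2 μ →L[ℂ] Lp ℂ 2 μ}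
    (hT : ∀ g, T g =ᵐ[μ] fun ξ => ∫ η, convKernel a b w ξ η * g η ∂μ) :
    ‖T‖ₑ ^ 2 ≤ 4 * (c ^ 2 * μ S * (∫⁻ ξ, ‖w ξ‖ₑ ^ 2 ∂μ) +
      2 * N * ∫⁻ ξ in Sᶜ, ‖w ξ‖ₑ ^ 2 ∂μ) := by
  set X := 4 * (c ^ 2 * μ S * (∫⁻ ξ, ‖w ξ‖ₑ ^ 2 ∂μ) + 2 * N * ∫⁻ ξ in Sᶜ, ‖w ξ‖ₑ ^ 2 ∂μ) with hX
  have key (g : Lp ℂ 2 μ) : ‖T g‖ₑ ^ 2 ≤ X * ‖g‖ₑ ^ 2 := by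
    have hg := (Lp.stronglyMeasurable g).measurable.enorm
    -- `P₁ + P₂` bounds `T g` pointwise, with `P₁` from `w` on `S` and `P₂` from `w` off `S`.
    let w₁ := S.indicator w
    let w₂ := Sᶜ.indicator w
    have hw₁ : Measurable w₁ := hw.indicator hS
    have hw₂ : Measurable w₂ := hw.indicator hS.compl
    have hK₁ := (stronglyMeasurable_convKernel ha hb hw₁).measurable.enorm
    have hK₂ := (stronglyMeasurable_convKernel ha hb hw₂).measurable.enorm
    let P₁ : G → ℝ≥0∞ := fun ξ => ∫⁻ η, ‖convKernel a b w₁ ξ η‖ₑ * ‖g η‖ₑ ∂μ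
    let P₂ : G → ℝ≥0∞ := fun ξ => ∫⁻ η, ‖convKernel a b w₂ ξ η‖ₑ * ‖g η‖ₑ ∂μ
    have hP₁m : Measurable P₁ :=
      Measurable.lintegral_prod_right' (f := fun p : G × G => _)
        (hK₁.mul (hg.comp measurable_snd))
    have hsplit (ξ : G) : ‖∫ η, convKernel a b w ξ η * g η ∂μ‖ₑ ^ 2 ≤
        4 * (P₁ ξ ^ 2 + P₂ ξ ^ 2) := by
      have h1 : ‖∫ η, convKernel a b w ξ η * g η ∂μ‖ₑ ≤ P₁ ξ + P₂ ξ := by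
        refine (enorm_integral_le_lintegral_enorm _).trans ?_
        have hm : Measurable fun η => ‖convKernel a b w₁ ξ η‖ₑ * ‖g η‖ₑ :=
          (hK₁.comp measurable_prodMk_left).mul hg
        refine le_of_le_of_eq ?_ (lintegral_add_left hm _)
        refine lintegral_mono fun η => ?_
        rw [enorm_mul, ← add_mul]
        gcongr
        by_cases h : ξ - η ∈ S <;> simp [convKernel, w₁, w₂, h]
      calc _ ≤ (P₁ ξ + P₂ ξ) ^ 2 := pow_le_pow_left₀ zero_le h1 2
        _ ≤ 4 * (P₁ ξ ^ 2 + P₂ ξ ^ 2) := by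
          rcases le_total (P₁ ξ) (P₂ ξ) with h | h
          · calc (P₁ ξ + P₂ ξ) ^ 2 ≤ (P₂ ξ + P₂ ξ) ^ 2 := by gcongr
              _ = 4 * P₂ ξ ^ 2 := by ring
              _ ≤ _ := by gcongr; exact le_add_self
          · calc (P₁ ξ + P₂ ξ) ^ 2 ≤ (P₁ ξ + P₁ ξ) ^ 2 := by gcongr
              _ = 4 * P₁ ξ ^ 2 := by ring
              _ ≤ _ := by gcongr; exact le_self_add
    have hP₁ : ∫⁻ ξ, P₁ ξ ^ 2 ∂μ ≤ c ^ 2 * μ S * (∫⁻ ξ, ‖w ξ‖ₑ ^ 2 ∂μ) * ‖g‖ₑ ^ 2 := by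
      have h1S : Measurable (S.indicator (1 : G → ℝ≥0∞)) := measurable_one.indicator hS
      have hpt (ξ : G) : P₁ ξ ^ 2 ≤
          c ^ 2 * μ S * ∫⁻ η, ‖g η‖ₑ ^ 2 * ‖w (ξ - η)‖ₑ ^ 2 ∂μ := by
        have hind : Measurable fun η => S.indicator (1 : G → ℝ≥0∞) (ξ - η) :=
          h1S.comp (measurable_const.sub measurable_id)
        have hwm : Measurable fun η => ‖w (ξ - η)‖ₑ :=
          (hw.comp (measurable_const.sub measurable_id)).enorm
        calc P₁ ξ ^ 2 = (∫⁻ η, (‖a ξ‖ₑ * ‖b η‖ₑ * S.indicator (1 : G → ℝ≥0∞) (ξ - η)) *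
              (‖g η‖ₑ * ‖w (ξ - η)‖ₑ) ∂μ) ^ 2 := by
              congr 1
              refine lintegral_congr fun η => ?_
              by_cases h : ξ - η ∈ S
              · simp only [convKernel, w₁, h, Set.indicator_of_mem, enorm_mul, Pi.one_apply]
                ring
              · simp [convKernel, w₁, h]
          _ ≤ (∫⁻ η, (‖a ξ‖ₑ * ‖b η‖ₑ * S.indicator (1 : G → ℝ≥0∞) (ξ - η)) ^ 2 ∂μ) *
              ∫⁻ η, (‖g η‖ₑ * ‖w (ξ - η)‖ₑ) ^ 2 ∂μ :=
              sq_lintegral_mul_le ((hb.enorm.const_mul _).mul hind).aemeasurable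
                (hg.mul hwm).aemeasurable
          _ ≤ (∫⁻ η, c ^ 2 * S.indicator (1 : G → ℝ≥0∞) (ξ - η) ∂μ) *
              ∫⁻ η, ‖g η‖ₑ ^ 2 * ‖w (ξ - η)‖ₑ ^ 2 ∂μ := by
              simp_rw [mul_pow]
              gcongr with η
              · rw [pow_two c]
                exact mul_le_mul' (hac ξ) (hbc η)
              · by_cases h : ξ - η ∈ S <;> simp [h]
          _ = _ := by
              rw [lintegral_const_mul _ hind, lintegral_sub_left_eq_self,
                lintegral_indicator_one hS]
      have hgw : Measurable fun p : G × G => ‖g p.2‖ₑ ^ 2 * ‖w (p.1 - p.2)‖ₑ ^ 2 :=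
        ((hg.pow_const 2).comp measurable_snd).mul
          ((hw.enorm.pow_const 2).comp (measurable_fst.sub measurable_snd))
      refine (lintegral_mono hpt).trans ?_
      rw [lintegral_const_mul _ hgw.lintegral_prod_right',
        lintegral_lintegral_right_weight (hg.pow_const 2) (hw.enorm.pow_const 2), sq_enorm_Lp]
      exact le_of_eq (by ring)
    have hP₂ : ∫⁻ ξ, P₂ ξ ^ 2 ∂μ ≤ 2 * N * (∫⁻ ξ in Sᶜ, ‖w ξ‖ₑ ^ 2 ∂μ) * ‖g‖ₑ ^ 2 := by
      have hpt (ξ : G) : P₂ ξ ^ 2 ≤ (∫⁻ η, ‖convKernel a b w₂ ξ η‖ₑ ^ 2 ∂μ) * ‖g‖ₑ ^ 2 := by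
        rw [sq_enorm_Lp]
        exact sq_lintegral_mul_le (hK₂.comp measurable_prodMk_left).aemeasurable hg.aemeasurable
      have hm : Measurable fun ξ => ∫⁻ η, ‖convKernel a b w₂ ξ η‖ₑ ^ 2 ∂μ :=
        (hK₂.pow_const 2).lintegral_prod_right'
      refine (lintegral_mono hpt).trans ?_
      rw [lintegral_mul_const _ hm]
      gcongr
      refine (lintegral_sq_convKernel_le ha hb hw₂ haN hbN).trans (le_of_eq ?_)
      rw [← lintegral_indicator hS.compl]
      congr 1
      refine lintegral_congr fun ξ => ?_
      by_cases h : ξ ∈ S <;> simp [w₂, h]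
    calc ‖T g‖ₑ ^ 2 = ∫⁻ ξ, ‖∫ η, convKernel a b w ξ η * g η ∂μ‖ₑ ^ 2 ∂μ := by
          rw [sq_enorm_Lp]
          refine lintegral_congr_ae ?_
          filter_upwards [hT g] with ξ hξ
          rw [hξ]
      _ ≤ ∫⁻ ξ, 4 * (P₁ ξ ^ 2 + P₂ ξ ^ 2) ∂μ := lintegral_mono hsplit
      _ = 4 * ((∫⁻ ξ, P₁ ξ ^ 2 ∂μ) + ∫⁻ ξ, P₂ ξ ^ 2 ∂μ) := by
          rw [lintegral_const_mul' _ _ (by norm_num), lintegral_add_left (hP₁m.pow_const 2)]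
      _ ≤ 4 * (c ^ 2 * μ S * (∫⁻ ξ, ‖w ξ‖ₑ ^ 2 ∂μ) * ‖g‖ₑ ^ 2 +
          2 * N * (∫⁻ ξ in Sᶜ, ‖w ξ‖ₑ ^ 2 ∂μ) * ‖g‖ₑ ^ 2) := by gcongr
      _ = X * ‖g‖ₑ ^ 2 := by rw [hX]; ring
  rcases eq_or_ne X ∞ with hX' | hX'
  · rw [hX']
    exact le_top
  · have hop : ‖T‖ ≤ √X.toReal := by
      refine T.opNorm_le_bound (Real.sqrt_nonneg _) fun g => ?_
      refine (sq_le_sq₀ (norm_nonneg _) (by positivity)).1 ?_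
      rw [mul_pow, Real.sq_sqrt ENNReal.toReal_nonneg]
      have h2 := ENNReal.toReal_mono (ENNReal.mul_ne_top hX' (by finiteness)) (key g)
      simpa [ENNReal.toReal_mul, ENNReal.toReal_pow] using h2
    rw [← ofReal_norm, ← ENNReal.ofReal_pow (norm_nonneg _)]
    refine ENNReal.ofReal_le_of_le_toReal ?_
    calc ‖T‖ ^ 2 ≤ √X.toReal ^ 2 := pow_le_pow_left₀ (norm_nonneg _) hop 2
      _ = X.toReal := Real.sq_sqrt ENNReal.toReal_nonneg

end Convolution
/-! ### Sandwiched multiplication operators on the Fourier side -/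

section Sandwich

theorem norm_symbol_sq {κ s : ℝ} (hs : s ^ 2 = 1) (ξ : ℝ) :
    ‖symbol κ s ξ‖ ^ 2 = (√(κ ^ 2 + ξ ^ 2))⁻¹ := by
  have h : ‖(κ : ℂ) + I * s * ξ‖ = √(κ ^ 2 + ξ ^ 2) := by
    have e : (κ : ℂ) + I * s * ξ = (κ : ℂ) + (s * ξ : ℝ) * I := by push_cast; ring
    rw [e, Complex.norm_add_mul_I, mul_pow, hs, one_mul]
  rw [symbol, Complex.norm_cpow_real, h, ← Real.rpow_natCast, ← Real.rpow_mul (Real.sqrt_nonneg _)]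
  norm_num [Real.rpow_neg_one]

theorem enorm_symbol_sq_le {κ : ℝ} (hκ : 0 < κ) {s : ℝ} (hs : s ^ 2 = 1) (ξ : ℝ) :
    ‖symbol κ s ξ‖ₑ ^ 2 ≤ ENNReal.ofReal (1 / κ) := by
  rw [← ofReal_norm, ← ENNReal.ofReal_pow (norm_nonneg _), norm_symbol_sq hs, one_div]
  refine ENNReal.ofReal_le_ofReal (inv_anti₀ hκ (Real.le_sqrt_of_sq_le ?_))
  nlinarith [sq_nonneg ξ]

theorem enorm_symbol_pow_four {κ s : ℝ} (hs : s ^ 2 = 1) (ξ : ℝ) :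
    ‖symbol κ s ξ‖ₑ ^ 4 = ENNReal.ofReal (1 / (κ ^ 2 + ξ ^ 2)) := by
  rw [← ofReal_norm, ← ENNReal.ofReal_pow (norm_nonneg _), show 4 = 2 * 2 from rfl, pow_mul,
    norm_symbol_sq hs, inv_pow, Real.sq_sqrt (by positivity), one_div]

universe u

variable {G : Type u} [AddCommGroup G] [MeasurableSpace G] [MeasurableAdd₂ G] [MeasurableNeg G]
  [MeasurableSub₂ G] {μ : Measure G} [SFinite μ] [μ.IsAddLeftInvariant] [μ.IsNegInvariant]
  {H : Type u} [NormedAddCommGroup H] [InnerProductSpace ℂ H]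

/-- The operator `(κ + s ∂)^{-1/2} v (κ + t ∂)^{-1/2}`, written on the frequency group `G`: `U` is
the Fourier transform, `w` the transform of `v` and `ω` the angular frequency. -/
theorem exists_sandwich (U : H ≃ₗᵢ[ℂ] Lp ℂ 2 μ) {ω : G → ℝ} (hω : Measurable ω) {κ s t : ℝ}
    (hκ : 0 < κ) (hs : s ^ 2 = 1) (ht : t ^ 2 = 1) {N : ℝ} (hN0 : 0 ≤ N)
    (hN : ∫⁻ ξ, ENNReal.ofReal (1 / (κ ^ 2 + ω ξ ^ 2)) ∂μ ≤ ENNReal.ofReal N) (w : Lp ℂ 2 μ) :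
    ∃ T : H →L[ℂ] H,
      (∀ f, U (T f) =ᵐ[μ] fun ξ => symbol κ s (ω ξ) *
        ∫ η, w (ξ - η) * (symbol κ t (ω η) * U f η) ∂μ) ∧
      HSBound T (2 * N * ‖w‖ ^ 2) ∧
      ∀ S, MeasurableSet S → ‖T‖ₑ ^ 2 ≤ 4 * (ENNReal.ofReal (1 / κ) ^ 2 * μ S * ‖w‖ₑ ^ 2 +
        2 * ENNReal.ofReal N * ∫⁻ ξ in Sᶜ, ‖w ξ‖ₑ ^ 2 ∂μ) := by
  have ha : Measurable fun ξ => symbol κ s (ω ξ) := (measurable_symbol κ s).comp hω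
  have hb : Measurable fun ξ => symbol κ t (ω ξ) := (measurable_symbol κ t).comp hω
  have hw : Measurable w := (Lp.stronglyMeasurable w).measurable
  have haN : ∫⁻ ξ, ‖symbol κ s (ω ξ)‖ₑ ^ 4 ∂μ ≤ ENNReal.ofReal N := by
    simpa only [enorm_symbol_pow_four hs] using hN
  have hbN : ∫⁻ ξ, ‖symbol κ t (ω ξ)‖ₑ ^ 4 ∂μ ≤ ENNReal.ofReal N := by
    simpa only [enorm_symbol_pow_four ht] using hN
  have hK := stronglyMeasurable_convKernel ha hb hw
  have hKM : ∫⁻ ξ, ∫⁻ η, ‖convKernel (fun ξ => symbol κ s (ω ξ)) (fun ξ => symbol κ t (ω ξ)) w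
      ξ η‖ₑ ^ 2 ∂μ ∂μ ≤ ENNReal.ofReal (2 * N * ‖w‖ ^ 2) := by
    refine (lintegral_sq_convKernel_le ha hb hw haN hbN).trans (le_of_eq ?_)
    rw [← sq_enorm_Lp, ENNReal.ofReal_mul (by positivity), ENNReal.ofReal_mul (by positivity),
      ENNReal.ofReal_pow (norm_nonneg _), ofReal_norm, ENNReal.ofReal_ofNat]
  obtain ⟨A, hA⟩ := exists_kernelOperator hK (ne_top_of_le_ne_top ENNReal.ofReal_ne_top hKM)
  let T : H →L[ℂ] H :=
    (U.symm : Lp ℂ 2 μ →L[ℂ] H).comp (A.comp (U : H →L[ℂ] Lp ℂ 2 μ))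
  have hT (f : H) : U (T f) = A (U f) := U.apply_symm_apply _
  refine ⟨T, fun f => ?_, ?_, fun S hS => ?_⟩
  · rw [hT]
    filter_upwards [hA (U f)] with ξ hξ
    rw [hξ, ← integral_const_mul]
    refine integral_congr_ae (Eventually.of_forall fun η => ?_)
    simp only [convKernel]
    ring
  · exact (hsBound_of_kernel hK (by positivity) hKM hA).conj_unitary U hT
  · have h1 : ‖T‖ₑ ≤ ‖A‖ₑ := by
      rw [← ofReal_norm, ← ofReal_norm]
      exact ENNReal.ofReal_le_ofReal (norm_le_of_conj_unitary U hT)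
    rw [sq_enorm_Lp w]
    exact (pow_le_pow_left₀ zero_le h1 2).trans (sq_enorm_convOperator_le ha hb hw haN hbN
      (fun _ => enorm_symbol_sq_le hκ hs _) (fun _ => enorm_symbol_sq_le hκ ht _) hS hA)

variable [CompleteSpace H]

omit [AddCommGroup G] [MeasurableAdd₂ G] [MeasurableNeg G] [MeasurableSub₂ G] [SFinite μ]
  [μ.IsAddLeftInvariant] [μ.IsNegInvariant] in
/-- The limit and the uniform convergence for a bounded tight family `Q`, from the two operator
bounds. -/
theorem limit_and_series_of_bounds (U : H ≃ₗᵢ[ℂ] Lp ℂ 2 μ) {Q : Set H}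
    (hQ : Bornology.IsBounded Q)
    (htight : ∀ ε : ℝ≥0∞, 0 < ε → ∃ S : Set G, MeasurableSet S ∧ μ S ≠ ∞ ∧
      ∀ q ∈ Q, ∫⁻ ξ in Sᶜ, ‖U q ξ‖ₑ ^ 2 ∂μ ≤ ε)
    {L Γ : ℝ → H → H →L[ℂ] H} {C : ℝ} (hC : 0 ≤ C)
    (hL : ∀ κ : ℝ, 1 ≤ κ → ∀ q ∈ Q, HSBound (L κ q) (2 * (C / κ) * ‖q‖ ^ 2))
    (hΓ : ∀ κ : ℝ, 1 ≤ κ → ∀ q ∈ Q, HSBound (Γ κ q) (2 * (C / κ) * ‖q‖ ^ 2))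
    (hop : ∀ κ : ℝ, 1 ≤ κ → ∀ q ∈ Q, ∀ S, MeasurableSet S →
      ‖L κ q‖ₑ ^ 2 ≤ 4 * (ENNReal.ofReal (1 / κ) ^ 2 * μ S * ‖q‖ₑ ^ 2 +
        2 * ENNReal.ofReal (C / κ) * ∫⁻ ξ in Sᶜ, ‖U q ξ‖ₑ ^ 2 ∂μ)) :
    Tendsto (fun κ : ℝ => ⨆ q ∈ Q, ENNReal.ofReal (√κ * ‖L κ q‖)) atTop (𝓝 0) ∧
    ∃ κ₀ : ℝ, 1 ≤ κ₀ ∧ TendstoUniformlyOn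
      (fun (n : ℕ) (p : ℝ × H) => ∑ ℓ ∈ Finset.Icc 1 n,
        (1 / (ℓ : ℂ)) * trace (((I * p.1) • (L p.1 p.2 * Γ p.1 p.2)) ^ ℓ))
      (fun p => ∑' n : ℕ, (1 / ((n + 1 : ℕ) : ℂ)) *
        trace (((I * p.1) • (L p.1 p.2 * Γ p.1 p.2)) ^ (n + 1))) atTop (Set.Ici κ₀ ×ˢ Q) := by
  obtain ⟨B, hB⟩ := hQ.exists_norm_le
  have hmono {A : H →L[ℂ] H} {κ : ℝ} (hκ : 1 ≤ κ) {q : H} (hq : q ∈ Q)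
      (h : HSBound A (2 * (C / κ) * ‖q‖ ^ 2)) : HSBound A (2 * C * B ^ 2 / κ) := by
    intro ι e he s
    refine (h ι e he s).trans ?_
    calc 2 * (C / κ) * ‖q‖ ^ 2 ≤ 2 * (C / κ) * B ^ 2 := by
          have := hB q hq
          gcongr
      _ = 2 * C * B ^ 2 / κ := by ring
  have hlim : Tendsto (fun κ : ℝ => ⨆ q ∈ Q, ENNReal.ofReal (√κ * ‖L κ q‖)) atTop (𝓝 0) := by
    refine tendsto_iSup_sqrt_mul_norm fun ε hε => ?_
    -- The tail enters `κ ‖L‖²` with the factor `8 C`.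
    have hδ : 0 < ε / (8 * (C + 1)) := by positivity
    obtain ⟨S, hS, hSfin, hSQ⟩ := htight _ (ENNReal.ofReal_pos.2 hδ)
    refine ⟨4 * (μ S).toReal * B ^ 2, fun κ hκ q hq => ?_⟩
    have hκ0 : 0 < κ := by linarith
    have h1 : ‖L κ q‖ₑ ^ 2 ≤ 4 * (ENNReal.ofReal (1 / κ) ^ 2 * μ S * ‖q‖ₑ ^ 2 +
        2 * ENNReal.ofReal (C / κ) * ENNReal.ofReal (ε / (8 * (C + 1)))) := by
      refine (hop κ hκ q hq S hS).trans ?_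
      gcongr
      exact hSQ q hq
    have h2 := ENNReal.toReal_mono (by finiteness) h1
    rw [ENNReal.toReal_mul, ENNReal.toReal_add (by finiteness) (by finiteness)] at h2
    simp only [ENNReal.toReal_mul, ENNReal.toReal_pow, toReal_enorm, ENNReal.toReal_ofNat,
      ENNReal.toReal_ofReal (div_nonneg zero_le_one hκ0.le), ENNReal.toReal_ofReal hδ.le,
      ENNReal.toReal_ofReal (div_nonneg hC hκ0.le)] at h2
    have hq2 : ‖q‖ ^ 2 ≤ B ^ 2 := pow_le_pow_left₀ (norm_nonneg _) (hB q hq) 2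
    calc κ * ‖L κ q‖ ^ 2
        ≤ κ * (4 * ((1 / κ) ^ 2 * (μ S).toReal * ‖q‖ ^ 2 +
            2 * (C / κ) * (ε / (8 * (C + 1))))) := by gcongr
      _ = 4 * (μ S).toReal * ‖q‖ ^ 2 / κ + ε * (C / (C + 1)) := by
          field_simp
          ring
      _ ≤ 4 * (μ S).toReal * B ^ 2 / κ + ε * 1 := by
          gcongr
          exact div_le_one_of_le₀ (by linarith) (by linarith)
      _ = _ := by rw [mul_one]
  exact ⟨hlim, exists_tendstoUniformlyOn_trace_series (fun κ hκ q hq => hmono hκ hq (hL κ hκ q hq))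
    (fun κ hκ q hq => hmono hκ hq (hΓ κ hκ q hq)) hlim⟩

end Sandwich

/-! ### The line: Fourier transform of a product, and the symbol -/

namespace Line

theorem fourier_mul_schwartz (φ ψ : SchwartzMap ℝ ℂ) (ξ : ℝ) :
    ∫ x, Real.fourierChar (-(x * ξ)) • (φ x * ψ x) = ∫ η, 𝓕 φ (ξ - η) * 𝓕 ψ η := by
  have hφ : Integrable fun x : ℝ => Real.fourierChar (-(x * ξ)) • φ x := by
    simpa [mul_comm] using! (VectorFourier.fourierIntegral_convergent_iff Real.continuous_fourierChar
      (L := innerₗ ℝ) (by fun_prop) ξ).2 (φ.integrable (μ := volume))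
  have h := VectorFourier.integral_fourierIntegral_smul_eq_flip (L := -innerₗ ℝ)
    (μ := volume) (ν := volume) Real.continuous_fourierChar (by fun_prop) hφ (𝓕 ψ : SchwartzMap ℝ ℂ).integrable
  have h1 (η : ℝ) : VectorFourier.fourierIntegral Real.fourierChar volume (-innerₗ ℝ)
      (fun x : ℝ => Real.fourierChar (-(x * ξ)) • φ x) η = 𝓕 φ (ξ - η) := by
    rw [SchwartzMap.fourier_coe, Real.fourier_real_eq, VectorFourier.fourierIntegral]
    refine integral_congr_ae (Eventually.of_forall fun x => ?_)
    simp only [smul_smul, ← AddChar.map_add_eq_mul]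
    congr 2
    simp
    ring
  have h2 (x : ℝ) : VectorFourier.fourierIntegral Real.fourierChar volume (-innerₗ ℝ).flip
      (𝓕 ψ : SchwartzMap ℝ ℂ) x = ψ x := by
    have hinv : (𝓕⁻ (𝓕 ψ : SchwartzMap ℝ ℂ) : SchwartzMap ℝ ℂ) = ψ :=
      FourierTransform.fourierInv_fourier_eq ψ
    refine Eq.trans ?_ (congrArg (fun f : SchwartzMap ℝ ℂ => f x) hinv)
    rw [SchwartzMap.fourierInv_coe, Real.fourierInv_eq, VectorFourier.fourierIntegral]
    refine integral_congr_ae (Eventually.of_forall fun y => ?_)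
    simp [mul_comm]
  simp only [h1, h2, smul_eq_mul] at h
  rw [h]
  simp only [smul_mul_assoc]

/-- The Fourier transform of a product of two `L²` functions is the convolution of their Fourier
transforms.  It holds for Schwartz functions, and both sides are continuous on `L² × L²`. -/
theorem fourier_mul (v g : L2) (ξ : ℝ) :
    𝓕 (fun x : ℝ => v x * g x) ξ = ∫ η, (𝓕 v : L2) (ξ - η) * (𝓕 g : L2) η := by
  rw [Real.fourier_real_eq]
  have hE : MemLp (fun x : ℝ => ((Real.fourierChar (-(x * ξ)) : _root_.Circle) : ℂ)) ∞ volume := by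
    refine memLp_top_of_bound (Continuous.aestronglyMeasurable ?_) 1
      (Eventually.of_forall fun x => (_root_.Circle.norm_coe _).le)
    exact continuous_subtype_val.comp (Real.continuous_fourierChar.comp (by fun_prop))
  have hmp : MeasurePreserving (fun η : ℝ => ξ - η) volume volume :=
    Measure.measurePreserving_sub_left volume ξ
  let B := ContinuousLinearMap.mul ℂ ℂ
  let F : L2 × L2 → ℂ := fun p => B.lpPairing volume 2 2 (B.holderL volume ∞ 2 2 (hE.toLp _) p.1) p.2
  let R : L2 × L2 → ℂ := fun p =>
    B.lpPairing volume 2 2 (Lp.compMeasurePreserving _ hmp (𝓕 p.1 : L2)) (𝓕 p.2 : L2)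
  have hF (v g : L2) : F (v, g) = ∫ x, Real.fourierChar (-(x * ξ)) • (v x * g x) := by
    simp only [F, ContinuousLinearMap.lpPairing_eq_integral]
    refine integral_congr_ae ?_
    filter_upwards [B.coeFn_holder (r := 2) (hE.toLp _) v, hE.coeFn_toLp] with x hx hx'
    simp only [ContinuousLinearMap.holderL_apply_apply, hx, hx', B, ContinuousLinearMap.mul_apply',
      Circle.smul_def, smul_eq_mul, mul_assoc]
  have hR (v g : L2) : R (v, g) = ∫ η, (𝓕 v : L2) (ξ - η) * (𝓕 g : L2) η := by
    simp only [R, ContinuousLinearMap.lpPairing_eq_integral]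
    refine integral_congr_ae ?_
    filter_upwards [Lp.coeFn_compMeasurePreserving (𝓕 v : L2) hmp] with η hη
    simp only [hη, B, ContinuousLinearMap.mul_apply', Function.comp]
  have hFc : Continuous F := by fun_prop
  have hRc : Continuous R := by
    have h1 := (Lp.isometry_compMeasurePreserving (E := ℂ) (p := 2) hmp).continuous
    have h2 : Continuous fun p : L2 × L2 => (𝓕 p.1 : L2) := by fun_prop
    have h3 : Continuous fun p : L2 × L2 => (𝓕 p.2 : L2) := by fun_prop
    exact ((B.lpPairing volume 2 2).continuous.comp (h1.comp h2)).clm_apply h3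
  rw [← hF, ← hR]
  have hd := SchwartzMap.denseRange_toLpCLM (F := ℂ) (E := ℝ) (μ := volume) (p := 2)
    ENNReal.ofNat_ne_top
  refine congrFun (Continuous.ext_on (hd.prodMap hd) hFc hRc ?_) (v, g)
  rintro _ ⟨⟨φ, ψ⟩, rfl⟩
  simp only [Prod.map, SchwartzMap.toLpCLM_apply]
  rw [hF, hR, SchwartzMap.toLp_fourier_eq, SchwartzMap.toLp_fourier_eq]
  have e1 := φ.coeFn_toLp 2 volume
  have e2 := ψ.coeFn_toLp 2 volume
  have e3 := (𝓕 φ).coeFn_toLp 2 volume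
  have e4 := (𝓕 ψ).coeFn_toLp 2 volume
  calc _ = ∫ x, Real.fourierChar (-(x * ξ)) • (φ x * ψ x) := by
        refine integral_congr_ae ?_
        filter_upwards [e1, e2] with x h1 h2
        rw [h1, h2]
    _ = ∫ η, 𝓕 φ (ξ - η) * 𝓕 ψ η := fourier_mul_schwartz φ ψ ξ
    _ = _ := by
        refine integral_congr_ae ?_
        filter_upwards [hmp.quasiMeasurePreserving.ae e3, e4] with x h1 h2
        rw [h1, h2]

theorem lintegral_one_div_sq_add_sq {κ : ℝ} (hκ : 0 < κ) :
    ∫⁻ ξ : ℝ, ENNReal.ofReal (1 / (κ ^ 2 + (2 * Real.pi * ξ) ^ 2)) =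
      ENNReal.ofReal (1 / 2 / κ) := by
  have hπ := Real.pi_pos
  have e (ξ : ℝ) : 1 / (κ ^ 2 + (2 * Real.pi * ξ) ^ 2) =
      1 / κ ^ 2 * (1 + (2 * Real.pi / κ * ξ) ^ 2)⁻¹ := by
    field_simp
  have hint : Integrable fun ξ : ℝ => 1 / κ ^ 2 * (1 + (2 * Real.pi / κ * ξ) ^ 2)⁻¹ :=
    (integrable_inv_one_add_sq.comp_mul_left' (by positivity)).const_mul _
  simp_rw [e]
  rw [← ofReal_integral_eq_lintegral_ofReal hint (Eventually.of_forall fun ξ => by positivity),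
    integral_const_mul, Measure.integral_comp_mul_left (fun y : ℝ => (1 + y ^ 2)⁻¹),
    integral_univ_inv_one_add_sq, abs_of_pos (by positivity), smul_eq_mul]
  congr 1
  field_simp

/-- Existence of the operator `(κ + s ∂)^{-1/2} v (κ + t ∂)^{-1/2}` on the line, with its
Hilbert–Schmidt and operator norm bounds. -/
theorem exists_isSandwich {κ s t : ℝ} (hκ : 0 < κ) (hs : s ^ 2 = 1) (ht : t ^ 2 = 1) (v : L2) :
    ∃ T, IsSandwich κ s t v T ∧ HSBound T (2 * (1 / 2 / κ) * ‖v‖ ^ 2) ∧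
      ∀ S, MeasurableSet S → ‖T‖ₑ ^ 2 ≤
        4 * (ENNReal.ofReal (1 / κ) ^ 2 * volume S * ‖v‖ₑ ^ 2 +
          2 * ENNReal.ofReal (1 / 2 / κ) * ∫⁻ ξ in Sᶜ, ‖(𝓕 v : L2) ξ‖ₑ ^ 2) := by
  obtain ⟨T, hT, hHS, hop⟩ := exists_sandwich (Lp.fourierTransformₗᵢ ℝ ℂ)
    (ω := fun ξ => 2 * Real.pi * ξ) (by fun_prop) hκ hs ht (N := 1 / 2 / κ) (by positivity)
    (lintegral_one_div_sq_add_sq hκ).le (𝓕 v : L2)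
  have hn : ‖(𝓕 v : L2)‖ = ‖v‖ := Lp.norm_fourier_eq v
  have hen : ‖(𝓕 v : L2)‖ₑ = ‖v‖ₑ := by rw [← ofReal_norm, ← ofReal_norm, hn]
  refine ⟨T, fun f => ?_, by rwa [hn] at hHS, by rwa [hen] at hop⟩
  refine (hT f).trans (Eventually.of_forall fun ξ => ?_)
  simp only
  rw [fourier_mul]
  congr 1
  refine integral_congr_ae ?_
  filter_upwards [halfResolvent_spec hκ t f] with η hη
  rw [hη]
  rfl

theorem IsSandwich.congr_ae {κ s t : ℝ} {v v' : ℝ → ℂ} {T : L2 →L[ℂ] L2}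
    (h : IsSandwich κ s t v T) (hv : v =ᵐ[volume] v') : IsSandwich κ s t v' T := by
  intro f
  refine (h f).trans (Eventually.of_forall fun ξ => ?_)
  have e : 𝓕 (fun x => v x * halfResolvent κ t f x) ξ =
      𝓕 (fun x => v' x * halfResolvent κ t f x) ξ := by
    rw [Real.fourier_real_eq, Real.fourier_real_eq]
    refine integral_congr_ae ?_
    filter_upwards [hv] with x hx
    rw [hx]
  simp only [e]

theorem isLambda_Λ {κ : ℝ} (hκ : 0 < κ) (q : L2) : IsLambda κ q (Λ κ q) := by
  obtain ⟨T, hT, -⟩ := exists_isSandwich hκ (s := -1) (t := 1) (by norm_num) (by norm_num) q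
  have h : ∃ T, IsLambda κ q T := ⟨T, hT⟩
  rw [Λ, dif_pos h]
  exact h.choose_spec

theorem exists_isGamma {κ : ℝ} (hκ : 0 < κ) (q : L2) :
    ∃ T, IsGamma κ q T ∧ HSBound T (2 * (1 / 2 / κ) * ‖q‖ ^ 2) := by
  obtain ⟨r, hn, hr⟩ := exists_Lp_conj q
  obtain ⟨T, hT, hHS, -⟩ := exists_isSandwich hκ (s := 1) (t := -1) (by norm_num) (by norm_num) r
  exact ⟨T, hT.congr_ae hr, by rwa [hn] at hHS⟩

theorem isGamma_Γ {κ : ℝ} (hκ : 0 < κ) (q : L2) : IsGamma κ q (Γ κ q) := by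
  obtain ⟨T, hT, -⟩ := exists_isGamma hκ q
  have h : ∃ T, IsGamma κ q T := ⟨T, hT⟩
  rw [Γ, dif_pos h]
  exact h.choose_spec

theorem hsBound_Λ {κ : ℝ} (hκ : 0 < κ) (q : L2) : HSBound (Λ κ q) (2 * (1 / 2 / κ) * ‖q‖ ^ 2) := by
  obtain ⟨T, hT, hHS, -⟩ := exists_isSandwich hκ (s := -1) (t := 1) (by norm_num) (by norm_num) q
  rwa [(isLambda_Λ hκ q).unique hT]

theorem hsBound_Γ {κ : ℝ} (hκ : 0 < κ) (q : L2) : HSBound (Γ κ q) (2 * (1 / 2 / κ) * ‖q‖ ^ 2) := by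
  obtain ⟨T, hT, hHS⟩ := exists_isGamma hκ q
  rwa [IsSandwich.unique (isGamma_Γ hκ q) hT]

theorem sq_enorm_Λ_le {κ : ℝ} (hκ : 0 < κ) (q : L2) {S : Set ℝ} (hS : MeasurableSet S) :
    ‖Λ κ q‖ₑ ^ 2 ≤ 4 * (ENNReal.ofReal (1 / κ) ^ 2 * volume S * ‖q‖ₑ ^ 2 +
      2 * ENNReal.ofReal (1 / 2 / κ) * ∫⁻ ξ in Sᶜ, ‖(𝓕 q : L2) ξ‖ₑ ^ 2) := by
  obtain ⟨T, hT, -, hop⟩ := exists_isSandwich hκ (s := -1) (t := 1) (by norm_num) (by norm_num) q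
  rw [(isLambda_Λ hκ q).unique hT]
  exact hop S hS

theorem IsEquicontinuous.exists_set {Q : Set L2} (hQ : IsEquicontinuous Q) (ε : ℝ≥0∞)
    (hε : 0 < ε) : ∃ S : Set ℝ, MeasurableSet S ∧ volume S ≠ ∞ ∧
      ∀ q ∈ Q, ∫⁻ ξ in Sᶜ, ‖(𝓕 q : L2) ξ‖ₑ ^ 2 ≤ ε := by
  obtain ⟨R, hR⟩ := hQ ε hε
  have hm : MeasurableSet {ξ : ℝ | R < |2 * Real.pi * ξ|} :=
    measurableSet_lt measurable_const (by fun_prop)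
  refine ⟨{ξ | R < |2 * Real.pi * ξ|}ᶜ, hm.compl, ?_, fun q hq => ?_⟩
  · refine ne_top_of_le_ne_top ?_ (measure_mono (t := Set.Icc (-(R / (2 * Real.pi)))
      (R / (2 * Real.pi))) fun ξ hξ => ?_)
    · exact measure_Icc_lt_top.ne
    · have hπ := Real.pi_pos
      rw [Set.mem_compl_iff, Set.mem_ofPred_eq, not_lt, abs_mul, abs_of_pos (by positivity)] at hξ
      rw [Set.mem_Icc, ← abs_le, le_div_iff₀ (by positivity)]
      linarith
  · rw [compl_compl]
    exact hR q hq

end Line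

/-! ### The circle: Fourier coefficients of a product, and the symbol -/

namespace Circle

theorem exists_hilbertBasis_count :
    ∃ b : HilbertBasis ℤ ℂ (Lp ℂ 2 (Measure.count : Measure ℤ)), ∀ f n, b.repr f n = f n := by
  let e : ℤ → Lp ℂ 2 (Measure.count : Measure ℤ) := fun n =>
    indicatorConstLp 2 (measurableSet_singleton n) (by simp) (1 : ℂ)
  have he (n : ℤ) (f : Lp ℂ 2 (Measure.count : Measure ℤ)) : ⟪e n, f⟫_ℂ = f n := by
    rw [L2.inner_indicatorConstLp_one, integral_singleton]
    simp
  have hen (n m : ℤ) : e n m = if n = m then 1 else 0 := by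
    have h : e n =ᵐ[Measure.count] _ := indicatorConstLp_coeFn
    rw [ae_eq_top.2 (by simp)] at h
    rw [(eventually_top.1 h) m]
    simp [Set.indicator_apply, eq_comm]
  have ho : Orthonormal ℂ e := by
    rw [orthonormal_iff_ite]
    intro i j
    rw [he, hen]
    simp [eq_comm]
  have hspan : (Submodule.span ℂ (Set.range e))ᗮ = ⊥ := by
    rw [Submodule.eq_bot_iff]
    intro f hf
    ext1
    refine Eventually.of_forall fun n => ?_
    have hn : e n ∈ Submodule.span ℂ (Set.range e) := Submodule.subset_span ⟨n, rfl⟩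
    rw [← he, Submodule.inner_right_of_mem_orthogonal hn hf]
    have h := Lp.coeFn_zero ℂ 2 (Measure.count : Measure ℤ)
    rw [Measure.ae_count_iff.1 h n, Pi.zero_apply]
  refine ⟨HilbertBasis.mkOfOrthogonalEqBot ho hspan, fun f n => ?_⟩
  rw [HilbertBasis.repr_apply_apply, HilbertBasis.coe_mkOfOrthogonalEqBot, he]

/-- The Fourier transform `L²(ℝ/ℤ) ≃ L²(ℤ)`, with `Lp` for the counting measure in place of `ℓ²`,
as the convolution operators act on `Lp`. -/
theorem exists_fourier_equiv :
    ∃ U : L2 ≃ₗᵢ[ℂ] Lp ℂ 2 (Measure.count : Measure ℤ), ∀ f n, U f n = fourierCoeff f n := by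
  obtain ⟨b, hb⟩ := exists_hilbertBasis_count
  refine ⟨fourierBasis.repr.trans b.repr.symm, fun f n => ?_⟩
  rw [← hb, LinearIsometryEquiv.trans_apply, LinearIsometryEquiv.apply_symm_apply,
    fourierBasis_repr]

/-- Parseval's identity, for the functions `conj (v e_{-n})` and `g`. -/
theorem hasSum_fourierCoeff_mul (v g : L2) (n : ℤ) :
    HasSum (fun m : ℤ => fourierCoeff v (n - m) * fourierCoeff g m)
      (fourierCoeff (fun x => v x * g x) n) := by
  have hu : MemLp (fun x : UnitAddCircle => conj (fourier (-n) x * v x)) 2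
      AddCircle.haarAddCircle := by
    refine MemLp.of_le (Lp.memLp v) (continuous_conj.comp_aestronglyMeasurable
      ((map_continuous (fourier (-n))).aestronglyMeasurable.mul (Lp.aestronglyMeasurable v))) ?_
    refine Eventually.of_forall fun x => ?_
    rw [RCLike.norm_conj, norm_mul, fourier_apply, _root_.Circle.norm_coe, one_mul]
  have h := fourierBasis.hasSum_inner_mul_inner (hu.toLp _) g
  have h1 (m : ℤ) : ⟪hu.toLp _, fourierBasis m⟫_ℂ = fourierCoeff v (n - m) := by
    rw [L2.inner_def, coe_fourierBasis, fourierCoeff]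
    refine integral_congr_ae ?_
    filter_upwards [hu.coeFn_toLp, coeFn_fourierLp 2 m] with x hx hm
    rw [hx, hm, RCLike.inner_apply', Complex.conj_conj, neg_sub, sub_eq_add_neg, fourier_add,
      smul_eq_mul]
    ring
  have h2 (m : ℤ) : ⟪fourierBasis m, g⟫_ℂ = fourierCoeff g m := by
    rw [← fourierBasis.repr_apply_apply, fourierBasis_repr]
  have h3 : ⟪hu.toLp _, g⟫_ℂ = fourierCoeff (fun x => v x * g x) n := by
    rw [L2.inner_def, fourierCoeff]
    refine integral_congr_ae ?_
    filter_upwards [hu.coeFn_toLp] with x hx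
    rw [hx, RCLike.inner_apply', Complex.conj_conj, smul_eq_mul]
    ring
  simpa only [h1, h2, h3] using h

theorem fourierCoeff_mul (v g : L2) (n : ℤ) :
    fourierCoeff (fun x => v x * g x) n =
      ∫ m : ℤ, fourierCoeff v (n - m) * fourierCoeff g m ∂Measure.count := by
  have h := hasSum_fourierCoeff_mul v g n
  rw [integral_countable]
  · simpa using h.tsum_eq.symm
  · rw [integrable_count_iff]
    exact h.summable.norm

/-- Comparison with the integral over the line: `κ² + (2πx)²` is at most
`(2 + 8π²/κ²) (κ² + (2πn)²)` for `x ∈ (n, n + 1]`. -/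
theorem lintegral_count_one_div_sq_add_sq_le {κ : ℝ} (hκ : 0 < κ) :
    ∫⁻ n : ℤ, ENNReal.ofReal (1 / (κ ^ 2 + (2 * Real.pi * n) ^ 2)) ∂Measure.count ≤
      ENNReal.ofReal ((1 + 4 * Real.pi ^ 2 / κ ^ 2) / κ) := by
  have hD : 0 ≤ 2 + 8 * Real.pi ^ 2 / κ ^ 2 := by positivity
  have hpt (n : ℤ) : ENNReal.ofReal (1 / (κ ^ 2 + (2 * Real.pi * n) ^ 2)) ≤
      ∫⁻ x in Set.Ioc (n : ℝ) (n + 1), ENNReal.ofReal (2 + 8 * Real.pi ^ 2 / κ ^ 2) *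
        ENNReal.ofReal (1 / (κ ^ 2 + (2 * Real.pi * x) ^ 2)) := by
    calc ENNReal.ofReal (1 / (κ ^ 2 + (2 * Real.pi * n) ^ 2))
        = ∫⁻ x in Set.Ioc (n : ℝ) (n + 1),
            ENNReal.ofReal (1 / (κ ^ 2 + (2 * Real.pi * n) ^ 2)) := by simp
      _ ≤ _ := by
        refine setLIntegral_mono' measurableSet_Ioc fun x hx => ?_
        rw [← ENNReal.ofReal_mul hD]
        refine ENNReal.ofReal_le_ofReal ?_
        rw [mul_one_div, div_le_div_iff₀ (by positivity) (by positivity), one_mul]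
        have h1 : x ^ 2 ≤ 2 * (n : ℝ) ^ 2 + 2 := by
          nlinarith [hx.1, hx.2, sq_nonneg (2 * (n : ℝ) - x)]
        have h2 : Real.pi ^ 2 * x ^ 2 ≤ Real.pi ^ 2 * (2 * (n : ℝ) ^ 2 + 2) := by gcongr
        have h3 : 8 * Real.pi ^ 2 / κ ^ 2 * κ ^ 2 = 8 * Real.pi ^ 2 := by field_simp
        have h4 : 0 ≤ 8 * Real.pi ^ 2 / κ ^ 2 * (2 * Real.pi * n) ^ 2 := by positivity
        nlinarith [sq_nonneg κ]
  rw [lintegral_count]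
  calc _ ≤ ∑' n : ℤ, ∫⁻ x in Set.Ioc (n : ℝ) (n + 1),
          ENNReal.ofReal (2 + 8 * Real.pi ^ 2 / κ ^ 2) *
            ENNReal.ofReal (1 / (κ ^ 2 + (2 * Real.pi * x) ^ 2)) := ENNReal.tsum_le_tsum hpt
    _ = ∫⁻ x : ℝ, ENNReal.ofReal (2 + 8 * Real.pi ^ 2 / κ ^ 2) *
          ENNReal.ofReal (1 / (κ ^ 2 + (2 * Real.pi * x) ^ 2)) := by
        rw [← lintegral_iUnion (fun _ => measurableSet_Ioc) (Set.pairwise_disjoint_Ioc_intCast ℝ),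
          iUnion_Ioc_intCast, Measure.restrict_univ]
    _ = ENNReal.ofReal ((1 + 4 * Real.pi ^ 2 / κ ^ 2) / κ) := by
        rw [lintegral_const_mul' _ _ ENNReal.ofReal_ne_top, Line.lintegral_one_div_sq_add_sq hκ,
          ← ENNReal.ofReal_mul hD]
        congr 1
        field_simp
        ring

/-- Existence of the operator `(κ + s ∂)^{-1/2} v (κ + t ∂)^{-1/2}` on the circle, with its
Hilbert–Schmidt and operator norm bounds. -/
theorem exists_isSandwich {U : L2 ≃ₗᵢ[ℂ] Lp ℂ 2 (Measure.count : Measure ℤ)}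
    (hU : ∀ f n, U f n = fourierCoeff f n) {κ s t : ℝ} (hκ : 0 < κ) (hs : s ^ 2 = 1)
    (ht : t ^ 2 = 1) {N : ℝ} (hN : (1 + 4 * Real.pi ^ 2 / κ ^ 2) / κ ≤ N) (v : L2) :
    ∃ T, IsSandwich κ s t v T ∧ HSBound T (2 * N * ‖v‖ ^ 2) ∧
      ∀ S, MeasurableSet S → ‖T‖ₑ ^ 2 ≤
        4 * (ENNReal.ofReal (1 / κ) ^ 2 * Measure.count S * ‖v‖ₑ ^ 2 +
          2 * ENNReal.ofReal N * ∫⁻ n in Sᶜ, ‖U v n‖ₑ ^ 2 ∂Measure.count) := by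
  obtain ⟨T, hT, hHS, hop⟩ := exists_sandwich U
    (ω := fun n : ℤ => 2 * Real.pi * n) (measurable_from_top) hκ hs ht
    (le_trans (by positivity) hN)
    ((lintegral_count_one_div_sq_add_sq_le hκ).trans (ENNReal.ofReal_le_ofReal hN)) (U v)
  have hen : ‖U v‖ₑ = ‖v‖ₑ := by rw [← ofReal_norm, ← ofReal_norm, U.norm_map]
  refine ⟨T, fun f n => ?_, by rwa [U.norm_map] at hHS, by rwa [hen] at hop⟩
  have h := Measure.ae_count_iff.1 (hT f) n
  rw [← hU, h, fourierCoeff_mul]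
  simp only [hU, halfResolvent_spec hκ t f]

theorem IsSandwich.congr_ae {κ s t : ℝ} {v v' : UnitAddCircle → ℂ} {T : L2 →L[ℂ] L2}
    (h : IsSandwich κ s t v T) (hv : v =ᵐ[AddCircle.haarAddCircle] v') :
    IsSandwich κ s t v' T := by
  intro f n
  rw [h f n]
  congr 1
  refine integral_congr_ae ?_
  filter_upwards [hv] with x hx
  rw [hx]

theorem isLambda_Λ {κ : ℝ} (hκ : 0 < κ) (q : L2) : IsLambda κ q (Λ κ q) := by
  obtain ⟨U, hU⟩ := exists_fourier_equiv
  obtain ⟨T, hT, -⟩ := exists_isSandwich hU hκ (s := -1) (t := 1) (by norm_num) (by norm_num)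
    le_rfl q
  have h : ∃ T, IsLambda κ q T := ⟨T, hT⟩
  rw [Λ, dif_pos h]
  exact h.choose_spec

theorem exists_isGamma {κ N : ℝ} (hκ : 0 < κ) (hN : (1 + 4 * Real.pi ^ 2 / κ ^ 2) / κ ≤ N)
    (q : L2) : ∃ T, IsGamma κ q T ∧ HSBound T (2 * N * ‖q‖ ^ 2) := by
  obtain ⟨U, hU⟩ := exists_fourier_equiv
  obtain ⟨r, hn, hr⟩ := exists_Lp_conj q
  obtain ⟨T, hT, hHS, -⟩ := exists_isSandwich hU hκ (s := 1) (t := -1) (by norm_num) (by norm_num)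
    hN r
  exact ⟨T, hT.congr_ae hr, by rwa [hn] at hHS⟩

theorem isGamma_Γ {κ : ℝ} (hκ : 0 < κ) (q : L2) : IsGamma κ q (Γ κ q) := by
  obtain ⟨T, hT, -⟩ := exists_isGamma hκ le_rfl q
  have h : ∃ T, IsGamma κ q T := ⟨T, hT⟩
  rw [Γ, dif_pos h]
  exact h.choose_spec

theorem hsBound_Λ {κ N : ℝ} (hκ : 0 < κ) (hN : (1 + 4 * Real.pi ^ 2 / κ ^ 2) / κ ≤ N) (q : L2) :
    HSBound (Λ κ q) (2 * N * ‖q‖ ^ 2) := by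
  obtain ⟨U, hU⟩ := exists_fourier_equiv
  obtain ⟨T, hT, hHS, -⟩ := exists_isSandwich hU hκ (s := -1) (t := 1) (by norm_num) (by norm_num)
    hN q
  rwa [(isLambda_Λ hκ q).unique hT]

theorem hsBound_Γ {κ N : ℝ} (hκ : 0 < κ) (hN : (1 + 4 * Real.pi ^ 2 / κ ^ 2) / κ ≤ N) (q : L2) :
    HSBound (Γ κ q) (2 * N * ‖q‖ ^ 2) := by
  obtain ⟨T, hT, hHS⟩ := exists_isGamma hκ hN q
  rwa [IsSandwich.unique (isGamma_Γ hκ q) hT]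

theorem sq_enorm_Λ_le {U : L2 ≃ₗᵢ[ℂ] Lp ℂ 2 (Measure.count : Measure ℤ)}
    (hU : ∀ f n, U f n = fourierCoeff f n) {κ N : ℝ} (hκ : 0 < κ)
    (hN : (1 + 4 * Real.pi ^ 2 / κ ^ 2) / κ ≤ N) (q : L2) {S : Set ℤ} (hS : MeasurableSet S) :
    ‖Λ κ q‖ₑ ^ 2 ≤ 4 * (ENNReal.ofReal (1 / κ) ^ 2 * Measure.count S * ‖q‖ₑ ^ 2 +
      2 * ENNReal.ofReal N * ∫⁻ n in Sᶜ, ‖U q n‖ₑ ^ 2 ∂Measure.count) := by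
  obtain ⟨T, hT, -, hop⟩ := exists_isSandwich hU hκ (s := -1) (t := 1) (by norm_num) (by norm_num)
    hN q
  rw [(isLambda_Λ hκ q).unique hT]
  exact hop S hS

theorem IsEquicontinuous.exists_set {U : L2 ≃ₗᵢ[ℂ] Lp ℂ 2 (Measure.count : Measure ℤ)}
    (hU : ∀ f n, U f n = fourierCoeff f n) {Q : Set L2} (hQ : IsEquicontinuous Q) (ε : ℝ≥0∞)
    (hε : 0 < ε) : ∃ S : Set ℤ, MeasurableSet S ∧ Measure.count S ≠ ∞ ∧
      ∀ q ∈ Q, ∫⁻ n in Sᶜ, ‖U q n‖ₑ ^ 2 ∂Measure.count ≤ ε := by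
  obtain ⟨R, hR⟩ := hQ ε hε
  refine ⟨{n : ℤ | R < |2 * Real.pi * n|}ᶜ, MeasurableSet.of_discrete, ?_, fun q hq => ?_⟩
  · refine (Measure.count_apply_lt_top.2 ?_).ne
    refine (Set.finite_Icc (-⌈R⌉) ⌈R⌉).subset fun n hn => ?_
    have hπ := Real.pi_gt_three
    rw [Set.mem_compl_iff, Set.mem_ofPred_eq, not_lt, abs_mul, abs_of_pos (by positivity)] at hn
    have h1 : |(n : ℝ)| ≤ ⌈R⌉ := by
      refine le_trans ?_ (Int.le_ceil R)
      nlinarith [abs_nonneg (n : ℝ)]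
    rw [Set.mem_Icc, ← abs_le]
    exact_mod_cast h1
  · rw [compl_compl, ← lintegral_indicator MeasurableSet.of_discrete, lintegral_count,
      ← tsum_subtype]
    simp only [hU]
    exact hR q hq

end Circle

end DNLS

theorem proposition2p6 :
    -- the line
    (∀ Q : Set DNLS.Line.L2, Bornology.IsBounded Q → DNLS.Line.IsEquicontinuous Q →
      -- the objects below are well defined
      (∀ κ : ℝ, 0 < κ → ∀ q ∈ Q,
        DNLS.Line.IsLambda κ q (DNLS.Line.Λ κ q) ∧ DNLS.Line.IsGamma κ q (DNLS.Line.Γ κ q) ∧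
        ∀ ℓ : ℕ, 1 ≤ ℓ → DNLS.IsTraceClass (DNLS.Line.kernelOp κ q ^ ℓ)) ∧
      Tendsto (fun κ : ℝ => ⨆ q ∈ Q, ENNReal.ofReal (√κ * ‖DNLS.Line.Λ κ q‖)) atTop (𝓝 0) ∧
      ∃ κ₀ : ℝ, 1 ≤ κ₀ ∧
        TendstoUniformlyOn
          (fun (n : ℕ) (p : ℝ × DNLS.Line.L2) => DNLS.Line.alphaPartial n p.1 p.2)
          (fun p => DNLS.Line.alpha p.1 p.2) atTop (Set.Ici κ₀ ×ˢ Q)) ∧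
    -- the circle
    (∀ Q : Set DNLS.Circle.L2, Bornology.IsBounded Q → DNLS.Circle.IsEquicontinuous Q →
      (∀ κ : ℝ, 0 < κ → ∀ q ∈ Q,
        DNLS.Circle.IsLambda κ q (DNLS.Circle.Λ κ q) ∧
        DNLS.Circle.IsGamma κ q (DNLS.Circle.Γ κ q) ∧
        ∀ ℓ : ℕ, 1 ≤ ℓ → DNLS.IsTraceClass (DNLS.Circle.kernelOp κ q ^ ℓ)) ∧
      Tendsto (fun κ : ℝ => ⨆ q ∈ Q, ENNReal.ofReal (√κ * ‖DNLS.Circle.Λ κ q‖)) atTop (𝓝 0) ∧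
      ∃ κ₀ : ℝ, 1 ≤ κ₀ ∧
        TendstoUniformlyOn
          (fun (n : ℕ) (p : ℝ × DNLS.Circle.L2) => DNLS.Circle.alphaPartial n p.1 p.2)
          (fun p => DNLS.Circle.alpha p.1 p.2) atTop (Set.Ici κ₀ ×ˢ Q)) := by
  refine ⟨fun Q hQ hE => ⟨fun κ hκ q _ => ⟨DNLS.Line.isLambda_Λ hκ q, DNLS.Line.isGamma_Γ hκ q,
      fun ℓ hℓ => DNLS.isTraceClass_pow (DNLS.Line.hsBound_Λ hκ q) (DNLS.Line.hsBound_Γ hκ q)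
        _ hℓ⟩, ?_⟩,
    fun Q hQ hE => ⟨fun κ hκ q _ => ⟨DNLS.Circle.isLambda_Λ hκ q, DNLS.Circle.isGamma_Γ hκ q,
      fun ℓ hℓ => DNLS.isTraceClass_pow (DNLS.Circle.hsBound_Λ hκ le_rfl q)
        (DNLS.Circle.hsBound_Γ hκ le_rfl q) _ hℓ⟩, ?_⟩⟩
  · exact DNLS.limit_and_series_of_bounds (Lp.fourierTransformₗᵢ ℝ ℂ) hQ hE.exists_set
      (L := DNLS.Line.Λ) (Γ := DNLS.Line.Γ) (C := 1 / 2) (by norm_num)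
      (fun κ hκ q _ => DNLS.Line.hsBound_Λ (by linarith) q)
      (fun κ hκ q _ => DNLS.Line.hsBound_Γ (by linarith) q)
      (fun κ hκ q _ S hS => DNLS.Line.sq_enorm_Λ_le (by linarith) q hS)
  · obtain ⟨U, hU⟩ := DNLS.Circle.exists_fourier_equiv
    have hN {κ : ℝ} (hκ : 1 ≤ κ) :
        (1 + 4 * Real.pi ^ 2 / κ ^ 2) / κ ≤ (1 + 4 * Real.pi ^ 2) / κ := by
      have h : 4 * Real.pi ^ 2 / κ ^ 2 ≤ 4 * Real.pi ^ 2 :=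
        div_le_self (by positivity) (one_le_pow₀ hκ)
      gcongr
    exact DNLS.limit_and_series_of_bounds U hQ (hE.exists_set hU)
      (L := DNLS.Circle.Λ) (Γ := DNLS.Circle.Γ) (C := 1 + 4 * Real.pi ^ 2) (by positivity)
      (fun κ hκ q _ => DNLS.Circle.hsBound_Λ (by linarith) (hN hκ) q)
      (fun κ hκ q _ => DNLS.Circle.hsBound_Γ (by linarith) (hN hκ) q)
      (fun κ hκ q _ S hS => DNLS.Circle.sq_enorm_Λ_le hU (by linarith) (hN hκ) q hS)
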